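/- **Setting.** All Lie algebras and modules are over $\mathbb C$. Let $\mathfrak g=\mathfrak{sl}_2$ with standard basis $e,h,f$. For $n\ge 0$ let $L(n)$ be the simple $(n+1)$-dimensional $\mathfrak g$-module with basis $v_n,v_{n-2},\dots,v_{-n}$ satisfying $$h v_{n-2j}=(n-2j)v_{n-2j},\qquad e v_{n-2j}=(n-j+1)v_{n-2j+2},\qquad f v_{n-2j}=(j+1)v_{n-2j-2}\qquad(0\le j\le n),$$ where $v_{n+2}=v_{-n-2}=0$. Let $\mathfrak L^3=\mathfrak g\ltimes L(3)$, with $L(3)$ an abelian ideal. Put $Q(0)=U(\mathfrak L^3)\otimes_{U(\mathfrak g)}L(0)$ and, for $\chi\in\mathbb C$, $Q(0,\chi)=Q(0)/(C-\chi)Q(0)$, where $C\in U(\mathfrak L^3)$ is the cubic discriminant $$C=v_{-1}^2v_1^2-27v_{-3}^2v_3^2-4v_{-1}^3v_3-4v_{-3}v_1^3+18v_{-3}v_{-1}v_1v_3 .$$ An $\mathfrak L^3$-module is called *$\mathfrak g$-Harish-Chandra* if its restriction to $\mathfrak g$ is a direct sum of simple finite-dimensional $\mathfrak g$-modules in which every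 isomorphism class occurs with finite multiplicity. The multiplicity of a simple finite-dimensional $\mathfrak g$-module $S$ in such a module $M$, that is, the number of summands isomorphic to $S$ in a decomposition into simple modules, is written $[M:S]$. **Proposition.** Let $\chi\in\mathbb C$, $\chi\neq 0$. Then $Q(0,\chi)$ is $\mathfrak g$-Harish-Chandra, and for every integer $k\ge 0$ (and for every decomposition of $Q(0,\chi)$ into simple finite-dimensional $\mathfrak g$-modules) $$[Q(0,\chi):L(k)]=k-2\left\lfloor\frac{k+2}{3}\right\rfloor+1 .$$ Moreover, $Q(0,\chi)$ has a simple quotient which is an infinite-dimensional $\mathfrak g$-Harish-Chandra module. Hence $\mathfrak L^3$ has infinite-dimensional simple $\mathfrak g$-Harish-Chandra modules, although $[\mathfrak L^3,\mathfrak r]\cap\mathfrak r_0=0$, where $\mathfrak r$ is the radical of $\mathfrak L^3$ and, for any choice of a Cartan subalgebra $\mathfrak h\subset\mathfrak g$, $\mathfrak r_0=\{x\in\mathfrak r:[\mathfrak h,x]=0\}$ is its zero weight space. -/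

import Mathlib

open scoped TensorProduct

noncomputable section

namespace HarishChandra

/-! ### Induced modules -/

section Induced

variable {g L : Type} [LieRing g] [LieAlgebra ℂ g] [LieRing L] [LieAlgebra ℂ L]

/-- The relations `(u x) ⊗ m = u ⊗ (x m)`, for `u ∈ U(L)`, `x ∈ g`, `m ∈ M`, as a
`U(L)`-submodule of `U(L) ⊗ M` (tensor product over `ℂ`). As `g` generates `U(g)`, the quotient by
it is the tensor product over `U(g)`. -/
def inductionRelations (i : g →ₗ⁅ℂ⁆ L) (M : Type) [AddCommGroup M] [Module ℂ M]
    [LieRingModule g M] :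
    Submodule (UniversalEnvelopingAlgebra ℂ L) (UniversalEnvelopingAlgebra ℂ L ⊗[ℂ] M) :=
  Submodule.span (UniversalEnvelopingAlgebra ℂ L)
    {t | ∃ (u : UniversalEnvelopingAlgebra ℂ L) (x : g) (m : M),
      t = (u * UniversalEnvelopingAlgebra.ι ℂ (i x)) ⊗ₜ[ℂ] m - u ⊗ₜ[ℂ] ⁅x, m⁆}

/-- The induced module `U(L) ⊗_{U(g)} M`, for a homomorphism of Lie algebras `i : g → L`. -/
abbrev Induced (i : g →ₗ⁅ℂ⁆ L) (M : Type) [AddCommGroup M] [Module ℂ M] [LieRingModule g M] :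
    Type :=
  (UniversalEnvelopingAlgebra ℂ L ⊗[ℂ] M) ⧸ inductionRelations i M

/-- For a `U(L)`-module `Q` and an element `z` of `U(L)`, the `U(L)`-submodule generated by
`z Q`; it is `z Q` itself when `z` is central. -/
def mulSubmodule (z : UniversalEnvelopingAlgebra ℂ L) (Q : Type) [AddCommGroup Q]
    [Module (UniversalEnvelopingAlgebra ℂ L) Q] : Submodule (UniversalEnvelopingAlgebra ℂ L) Q :=
  Submodule.span (UniversalEnvelopingAlgebra ℂ L) (Set.range fun q : Q => z • q)

end Induced

/-! ### Restriction and Harish-Chandra modules -/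

section Restriction

variable {g L : Type} [LieRing g] [LieAlgebra ℂ g] [LieRing L] [LieAlgebra ℂ L]

/-- The `L`-module `M` regarded as a `g`-module along `i : g → L`. -/
def Res (_i : g →ₗ⁅ℂ⁆ L) (M : Type) : Type := M

variable (i : g →ₗ⁅ℂ⁆ L) (M : Type) [AddCommGroup M] [Module ℂ M] [LieRingModule L M]
  [LieModule ℂ L M]

instance : AddCommGroup (Res i M) := inferInstanceAs (AddCommGroup M)

instance : Module ℂ (Res i M) := inferInstanceAs (Module ℂ M)

instance : LieRingModule g (Res i M) := LieRingModule.compLieHom M i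

instance : LieModule ℂ g (Res i M) := LieModule.compLieHom M i

/-- The set `s` of submodules exhibits the `g`-module `M` as the (internal) direct sum of simple
finite-dimensional `g`-modules. -/
structure IsSimpleDecomposition {M : Type} [AddCommGroup M] [Module ℂ M] [LieRingModule g M]
    [LieModule ℂ g M] (s : Set (LieSubmodule ℂ g M)) : Prop where
  irreducible : ∀ N ∈ s, LieModule.IsIrreducible ℂ g N
  finite : ∀ N ∈ s, Module.Finite ℂ N
  indep : sSupIndep s
  sSup_eq_top : sSup s = ⊤

/-- The summands of the family `s` that are isomorphic to the `g`-module `S`. -/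
def summandsOfType {M : Type} [AddCommGroup M] [Module ℂ M] [LieRingModule g M]
    [LieModule ℂ g M] (s : Set (LieSubmodule ℂ g M)) (S : Type) [AddCommGroup S] [Module ℂ S]
    [LieRingModule g S] : Set (LieSubmodule ℂ g M) :=
  {N ∈ s | Nonempty (N ≃ₗ⁅ℂ,g⁆ S)}

/-- The `L`-module `M` is `g`-Harish-Chandra: its restriction to `g` is a direct sum of simple
finite-dimensional `g`-modules, in which every isomorphism class occurs finitely many times. -/
def IsHarishChandra : Prop :=
  ∃ s : Set (LieSubmodule ℂ g (Res i M)), IsSimpleDecomposition s ∧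
    ∀ N ∈ s, (summandsOfType s N).Finite

/-- The weight space of weight zero of the radical of `L`, for a subalgebra `𝔥` of `g`. -/
def radicalZeroWeightSpace (i : g →ₗ⁅ℂ⁆ L) (𝔥 : LieSubalgebra ℂ g) : Submodule ℂ L where
  carrier := {x | x ∈ LieAlgebra.radical ℂ L ∧ ∀ h ∈ 𝔥, ⁅i h, x⁆ = 0}
  add_mem' := fun ha hb => ⟨add_mem ha.1 hb.1, fun h hh => by
    rw [lie_add, ha.2 h hh, hb.2 h hh, add_zero]⟩
  zero_mem' := ⟨zero_mem _, fun _ _ => lie_zero _⟩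
  smul_mem' := fun c _ hx => ⟨(LieAlgebra.radical ℂ L).smul_mem c hx.1, fun h hh => by
    rw [lie_smul, hx.2 h hh, smul_zero]⟩

end Restriction

/-! ### The simple modules of `sl₂` -/

/-- The Lie algebra of traceless complex `2 × 2` matrices. -/
abbrev Sl2 : Type := LieAlgebra.SpecialLinear.sl (Fin 2) ℂ

/-- The underlying space of the simple `sl₂`-module `L(n)` of dimension `n + 1`. The coordinate
with index `j` belongs to a basis vector `v_{n - 2j}` of weight `n - 2j`. -/
def Irrep (n : ℕ) : Type := Fin (n + 1) → ℂ

namespace Irrep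

variable (n : ℕ)

instance : AddCommGroup (Irrep n) := inferInstanceAs (AddCommGroup (Fin (n + 1) → ℂ))

instance : Module ℂ (Irrep n) := inferInstanceAs (Module ℂ (Fin (n + 1) → ℂ))

variable {n} in
/-- The coordinate of `w` at `v_{n - 2k}`, read as zero for `k > n`. -/
def coord (w : Irrep n) (k : ℕ) : ℂ := if hk : k < n + 1 then w ⟨k, hk⟩ else 0

variable {n} in
/-- The action of `!![a, b; c, -a]`, that is of `a h + b e + c f`, where
`h v_{n - 2j} = (n - 2j) v_{n - 2j}`, `e v_{n - 2j} = (n - j + 1) v_{n - 2j + 2}` and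
`f v_{n - 2j} = (j + 1) v_{n - 2j - 2}`, with `v_{n + 2} = v_{-n - 2} = 0`. -/
def act (x : Sl2) (w : Irrep n) : Irrep n := fun j =>
  x.1 0 0 * (((n : ℂ) - 2 * (j.1 : ℂ)) * coord w j.1)
    + x.1 0 1 * (((n : ℂ) - (j.1 : ℂ)) * coord w (j.1 + 1))
    + x.1 1 0 * ((j.1 : ℂ) * coord w (j.1 - 1))

theorem coord_add (v w : Irrep n) (k : ℕ) : coord (v + w) k = coord v k + coord w k := by
  unfold coord
  split_ifs
  · rfl
  · exact (add_zero 0).symm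

theorem coord_smul (c : ℂ) (w : Irrep n) (k : ℕ) : coord (c • w) k = c * coord w k := by
  unfold coord
  split_ifs
  · rfl
  · exact (mul_zero c).symm

theorem coord_act (x : Sl2) (w : Irrep n) (k : ℕ) (hk : k < n + 1) :
    coord (act x w) k = x.1 0 0 * (((n : ℂ) - 2 * (k : ℂ)) * coord w k)
      + x.1 0 1 * (((n : ℂ) - (k : ℂ)) * coord w (k + 1))
      + x.1 1 0 * ((k : ℂ) * coord w (k - 1)) := by
  rw [coord, dif_pos hk]
  rfl

theorem act_lie (x y : Sl2) (w : Irrep n) : act ⁅x, y⁆ w = act x (act y w) - act y (act x w) := by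
  have tr : ∀ z : Sl2, z.1 1 1 = -z.1 0 0 := fun z => by
    have h : z.1 0 0 + z.1 1 1 = 0 := by
      simpa [LieAlgebra.SpecialLinear.sl, Matrix.trace_fin_two] using z.2
    linear_combination h
  funext ⟨j, hj⟩
  change act _ w _ = act _ (act _ w) _ - act _ (act _ w) _
  have up : ∀ z : Sl2, ((n : ℂ) - (j : ℂ)) * coord (act z w) (j + 1) = ((n : ℂ) - (j : ℂ)) *
      (z.1 0 0 * (((n : ℂ) - 2 * ((j : ℂ) + 1)) * coord w (j + 1))
        + z.1 0 1 * (((n : ℂ) - ((j : ℂ) + 1)) * coord w (j + 2))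
        + z.1 1 0 * (((j : ℂ) + 1) * coord w j)) := fun z => by
    rcases Nat.lt_or_ge (j + 1) (n + 1) with h | h
    · rw [coord_act n z w _ h]
      push_cast
      rfl
    · obtain rfl : j = n := by omega
      simp
  have down : ∀ z : Sl2, (j : ℂ) * coord (act z w) (j - 1) = (j : ℂ) *
      (z.1 0 0 * (((n : ℂ) - 2 * ((j : ℂ) - 1)) * coord w (j - 1))
        + z.1 0 1 * (((n : ℂ) - ((j : ℂ) - 1)) * coord w j)
        + z.1 1 0 * (((j : ℂ) - 1) * coord w (j - 2))) := fun z => by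
    rcases j with _ | i
    · simp
    · rw [coord_act n z w _ (by omega)]
      have h1 : i + 1 - 1 = i := by omega
      have h2 : i + 1 - 2 = i - 1 := by omega
      rw [h1, h2]
      push_cast
      ring
  simp only [act, up, down, coord_act n _ w j hj, LieAlgebra.SpecialLinear.sl_bracket,
    Matrix.sub_apply, Matrix.mul_apply, Fin.sum_univ_two, tr]
  ring

instance : LieRingModule Sl2 (Irrep n) where
  bracket := act
  add_lie x y w := by
    funext j
    change act (x + y) w j = act x w j + act y w j
    have h : ∀ a b, (x + y).1 a b = x.1 a b + y.1 a b := fun _ _ => rfl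
    simp only [act, h]
    ring
  lie_add x v w := by
    funext j
    change act x (v + w) j = act x v j + act x w j
    simp only [act, coord_add]
    ring
  leibniz_lie x y w := by
    change act x (act y w) = act ⁅x, y⁆ w + act y (act x w)
    rw [act_lie, sub_add_cancel]

instance : LieModule ℂ Sl2 (Irrep n) where
  smul_lie c x w := by
    funext j
    change act (c • x) w j = c * act x w j
    have h : ∀ a b, (c • x).1 a b = c * x.1 a b := fun _ _ => rfl
    simp only [act, h]
    ring
  lie_smul c x w := by
    funext j
    change act x (c • w) j = c * act x w j
    simp only [act, coord_smul]
    ring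

/-- `L(n)` as an abelian Lie algebra. -/
instance : LieRing (Irrep n) where
  bracket _ _ := 0
  add_lie _ _ _ := (add_zero 0).symm
  lie_add _ _ _ := (add_zero 0).symm
  lie_self _ := rfl
  leibniz_lie _ _ _ := (add_zero 0).symm

instance : LieAlgebra ℂ (Irrep n) where
  lie_smul c _ _ := (smul_zero c).symm

/-- The action of `sl₂` on the abelian Lie algebra `L(n)` by derivations. -/
def derivation : Sl2 →ₗ⁅ℂ⁆ LieDerivation ℂ (Irrep n) (Irrep n) where
  toFun x :=
    { toLinearMap := LieModule.toEnd ℂ Sl2 (Irrep n) x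
      leibniz' := fun _ _ => (lie_zero x).trans (sub_zero 0).symm }
  map_add' x y := by
    ext w : 1
    exact add_lie x y w
  map_smul' c x := by
    ext w : 1
    exact smul_lie c x w
  map_lie' {x y} := by
    ext w : 1
    exact lie_lie x y w

end Irrep

/-! ### Conformal Galilei algebras -/

/-- The conformal Galilei algebra `L^n = sl₂ ⋉ L(n)`. -/
abbrev Galilei (n : ℕ) : Type :=
  LieAlgebra.SemiDirectSum (Irrep n) Sl2 (Irrep.derivation n)

/-- The inclusion of `sl₂` in `L^n`. -/
abbrev sl2Incl (n : ℕ) : Sl2 →ₗ⁅ℂ⁆ Galilei n :=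
  LieAlgebra.SemiDirectSum.inr (Irrep.derivation n)

/-- The basis vector `v_{n - 2j}` of the ideal `L(n)` of `L^n`, in the universal enveloping algebra
of `L^n`. -/
def radVec (n : ℕ) (j : Fin (n + 1)) : UniversalEnvelopingAlgebra ℂ (Galilei n) :=
  UniversalEnvelopingAlgebra.ι ℂ
    (LieAlgebra.SemiDirectSum.inl (Irrep.derivation n) (Pi.single j 1 : Fin (n + 1) → ℂ))

/-- The cubic discriminant, in terms of `v_3, v_1, v_{-1}, v_{-3}`. -/
def cubicDiscriminant : UniversalEnvelopingAlgebra ℂ (Galilei 3) :=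
  let v₃ := radVec 3 0
  let v₁ := radVec 3 1
  let w₁ := radVec 3 2
  let w₃ := radVec 3 3
  w₁ ^ 2 * v₁ ^ 2 - 27 * w₃ ^ 2 * v₃ ^ 2 - 4 * w₁ ^ 3 * v₃ - 4 * w₃ * v₁ ^ 3
    + 18 * w₃ * w₁ * v₁ * v₃

/-- `Q(0) = U(L^3) ⊗_{U(sl₂)} L(0)`. -/
abbrev Q0 : Type := Induced (sl2Incl 3) (Irrep 0)

/-- `Q(0, χ) = Q(0) / (C - χ) Q(0)`, where `C` is the cubic discriminant. -/
def Q0χ (χ : ℂ) : Type :=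
  Q0 ⧸ mulSubmodule (cubicDiscriminant - algebraMap ℂ _ χ) Q0

namespace Q0χ

variable (χ : ℂ)

instance : AddCommGroup (Q0χ χ) := inferInstanceAs (AddCommGroup (Q0 ⧸ mulSubmodule _ Q0))

instance : Module (UniversalEnvelopingAlgebra ℂ (Galilei 3)) (Q0χ χ) :=
  inferInstanceAs (Module _ (Q0 ⧸ mulSubmodule _ Q0))

instance : Module ℂ (Q0χ χ) := inferInstanceAs (Module ℂ (Q0 ⧸ mulSubmodule _ Q0))

instance : IsScalarTower ℂ (UniversalEnvelopingAlgebra ℂ (Galilei 3)) (Q0χ χ) :=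
  inferInstanceAs (IsScalarTower ℂ _ (Q0 ⧸ mulSubmodule _ Q0))

/-- `L^3` acts through its universal enveloping algebra. -/
instance : LieRingModule (Galilei 3) (Q0χ χ) where
  bracket x q := UniversalEnvelopingAlgebra.ι ℂ x • q
  add_lie x y q := by
    change UniversalEnvelopingAlgebra.ι ℂ (x + y) • q = _
    rw [map_add, add_smul]
  lie_add x p q := smul_add _ p q
  leibniz_lie x y q := by
    change UniversalEnvelopingAlgebra.ι ℂ x • UniversalEnvelopingAlgebra.ι ℂ y • q =
      UniversalEnvelopingAlgebra.ι ℂ ⁅x, y⁆ • q +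
        UniversalEnvelopingAlgebra.ι ℂ y • UniversalEnvelopingAlgebra.ι ℂ x • q
    let _ := LieRing.ofAssociativeRing (A := UniversalEnvelopingAlgebra ℂ (Galilei 3))
    rw [LieHom.map_lie, LieRing.of_associative_ring_bracket, sub_smul, mul_smul, mul_smul,
      sub_add_cancel]

instance : LieModule ℂ (Galilei 3) (Q0χ χ) where
  smul_lie c x q := by
    change UniversalEnvelopingAlgebra.ι ℂ (c • x) • q = c • UniversalEnvelopingAlgebra.ι ℂ x • q
    rw [map_smul, smul_assoc]
  lie_smul c x q := smul_comm (UniversalEnvelopingAlgebra.ι ℂ x) c q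

end Q0χ

end HarishChandra

end

/-!
The module `Q(0)` is the symmetric algebra of `L(3)`, that is, the algebra
`ℂ[X 0, X 1, X 2, X 3]` of polynomial functions of the coefficients of a binary cubic. There `sl₂`
acts by derivations, `L(3)` by multiplication, and `C - χ` acts as multiplication by `disc - χ`,
where `disc` is `sl₂`-invariant. Multiplicities are dimensions of spaces of highest weight vectors,
and the extremal projector lifts a highest weight vector of `Q(0, χ)` to a polynomial killed by
`e`, a seminvariant.

Translating a cubic so that its coefficient `X 1` vanishes shows that a seminvariant is, up to a
power of `X 0` in the denominator, a polynomial in `X 0`, the leading coefficient `H` of the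
Hessian and the leading coefficient `T` of the cubic covariant, which satisfy
`T ^ 2 = 4 H ^ 3 - 27 (X 0) ^ 2 disc`. Modulo `disc - χ` the powers of `X 0` can be cancelled and
`T ^ 2` eliminated, so the highest weight vectors of `Q(0, χ)` have the basis
`(X 0) ^ i H ^ j`, `(X 0) ^ i H ^ j T`, of weights `3 i + 2 j` and `3 i + 2 j + 3`.

The cyclic module `Q(0, χ)` has a simple quotient. On a finite-dimensional quotient the elements of
`L(3)`, and hence `disc`, would be nilpotent, whereas `disc` acts as `χ ≠ 0`.

Finally, the radical lies in `L(3)`, and a Cartan subalgebra of `sl₂` contains an element that is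
not nilpotent, so that it acts invertibly on `L(3)`.
-/

noncomputable section

namespace HarishChandra

open LieModule

/-! ### Highest weight vectors -/

section Sl2Triple

variable {K L M N : Type*} [Field K] [LieRing L] [LieAlgebra K L] {h e f : L}
  [AddCommGroup M] [Module K M] [LieRingModule L M] [LieModule K L M]
  [AddCommGroup N] [Module K N] [LieRingModule L N] [LieModule K L N]

variable (M) in
/-- The space of vectors of weight `μ` for the action of a single element `h` on `M`. -/
abbrev weightSpace (h : L) (μ : K) : Submodule K M := (toEnd K L M h).eigenspace μ

variable (M) in
/-- The vectors of `h`-weight `μ` killed by `e`: for an `sl₂`-triple `(h, e, f)`, the highest weight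
vectors of weight `μ` together with `0`. -/
def highestWeightSpace (h e : L) (μ : K) : Submodule K M :=
  weightSpace M h μ ⊓ LinearMap.ker (toEnd K L M e)

theorem mem_weightSpace {μ : K} {m : M} : m ∈ weightSpace M h μ ↔ ⁅h, m⁆ = μ • m :=
  Module.End.mem_eigenspace_iff

theorem mem_highestWeightSpace {μ : K} {m : M} :
    m ∈ highestWeightSpace M h e μ ↔ ⁅h, m⁆ = μ • m ∧ ⁅e, m⁆ = 0 := by
  rw [highestWeightSpace, Submodule.mem_inf, mem_weightSpace, LinearMap.mem_ker, toEnd_apply_apply]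

theorem map_mem_weightSpace (φ : M →ₗ⁅K,L⁆ N) {μ : K} {m : M} (hm : m ∈ weightSpace M h μ) :
    φ m ∈ weightSpace N h μ := by
  rw [mem_weightSpace] at hm ⊢
  rw [← LieModuleHom.map_lie, hm, map_smul]

theorem map_mem_highestWeightSpace (φ : M →ₗ⁅K,L⁆ N) {μ : K} {m : M}
    (hm : m ∈ highestWeightSpace M h e μ) : φ m ∈ highestWeightSpace N h e μ := by
  rw [mem_highestWeightSpace] at hm ⊢
  rw [← LieModuleHom.map_lie, ← LieModuleHom.map_lie, hm.1, hm.2, map_smul, map_zero]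
  exact ⟨rfl, rfl⟩

theorem map_mem_highestWeightSpace_iff {φ : M →ₗ⁅K,L⁆ N} (hφ : Function.Injective φ) {μ : K}
    {m : M} : φ m ∈ highestWeightSpace N h e μ ↔ m ∈ highestWeightSpace M h e μ := by
  refine ⟨fun hm => ?_, map_mem_highestWeightSpace φ⟩
  rw [mem_highestWeightSpace, ← LieModuleHom.map_lie, ← LieModuleHom.map_lie, ← map_smul,
    ← map_zero φ] at hm
  exact mem_highestWeightSpace.2 ⟨hφ hm.1, hφ hm.2⟩

theorem toEnd_pow_mem_weightSpace {x : L} {c : K} (hx : ⁅h, x⁆ = c • x) {μ : K} {m : M}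
    (hm : m ∈ weightSpace M h μ) (n : ℕ) :
    (toEnd K L M x ^ n) m ∈ weightSpace M h (μ + n * c) := by
  induction n with
  | zero => simpa using hm
  | succ n ih =>
    rw [mem_weightSpace] at ih ⊢
    rw [pow_succ', Module.End.mul_apply, toEnd_apply_apply, leibniz_lie, ih, hx, smul_lie, lie_smul,
      ← add_smul]
    congr 1
    push_cast
    ring

variable (t : IsSl2Triple h e f)
include t

theorem e_pow_mem_weightSpace {μ : K} {m : M} (hm : m ∈ weightSpace M h μ) (n : ℕ) :
    (toEnd K L M e ^ n) m ∈ weightSpace M h (μ + n * 2) :=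
  toEnd_pow_mem_weightSpace (t.lie_h_e_smul K) hm n

theorem f_pow_mem_weightSpace {μ : K} {m : M} (hm : m ∈ weightSpace M h μ) (n : ℕ) :
    (toEnd K L M f ^ n) m ∈ weightSpace M h (μ + n * -2) :=
  toEnd_pow_mem_weightSpace ((t.lie_lie_smul_f K).trans (neg_smul _ _).symm) hm n

theorem lie_e_f_pow_succ {μ : K} {m : M} (hm : m ∈ weightSpace M h μ) (n : ℕ) :
    ⁅e, (toEnd K L M f ^ (n + 1)) m⁆ =
      (toEnd K L M f ^ (n + 1)) ⁅e, m⁆ + ((n + 1) * (μ - n) : K) • (toEnd K L M f ^ n) m := by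
  have lie_e_lie_f (v : M) : ⁅e, ⁅f, v⁆⁆ = ⁅h, v⁆ + ⁅f, ⁅e, v⁆⁆ := by rw [leibniz_lie, t.lie_e_f]
  induction n with
  | zero => simp [lie_e_lie_f, mem_weightSpace.1 hm, add_comm]
  | succ n ih =>
    have hf (k : ℕ) (v : M) : ⁅f, (toEnd K L M f ^ k) v⁆ = (toEnd K L M f ^ (k + 1)) v := by
      rw [pow_succ', Module.End.mul_apply, toEnd_apply_apply]
    rw [← hf (n + 1) m, lie_e_lie_f, ih, mem_weightSpace.1 (f_pow_mem_weightSpace t hm (n + 1)),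
      lie_add, lie_smul, hf, hf, add_left_comm, ← add_smul]
    congr 2
    push_cast
    ring

variable [CharZero K]

theorem exists_eq_natCast_of_mem_highestWeightSpace {μ : K} {m : M}
    (hm : m ∈ highestWeightSpace M h e μ) (hm₀ : m ≠ 0) (hf : ∃ n, (toEnd K L M f ^ n) m = 0) :
    ∃ k : ℕ, μ = k := by
  obtain ⟨k, hk, hk'⟩ := Nat.exists_not_and_succ_of_not_zero_of_exists
    (p := fun n => (toEnd K L M f ^ n) m = 0) hm₀ hf
  refine ⟨k, ?_⟩
  have h₀ := lie_e_f_pow_succ t hm.1 k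
  rw [hk', lie_zero, (mem_highestWeightSpace.1 hm).2, map_zero, zero_add, eq_comm,
    smul_eq_zero_iff_left hk, mul_eq_zero, sub_eq_zero] at h₀
  exact h₀.resolve_left (Nat.cast_add_one_ne_zero k)

theorem f_pow_succ_eq_zero_of_mem_highestWeightSpace {k : ℕ} {m : M}
    (hm : m ∈ highestWeightSpace M h e (k : K)) (hf : ∃ n, (toEnd K L M f ^ n) m = 0) :
    (toEnd K L M f ^ (k + 1)) m = 0 := by
  by_contra h₀
  have hmem : (toEnd K L M f ^ (k + 1)) m ∈
      highestWeightSpace M h e ((k : K) + (k + 1 : ℕ) * -2) := by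
    refine mem_highestWeightSpace.2 ⟨mem_weightSpace.1 (f_pow_mem_weightSpace t hm.1 _), ?_⟩
    rw [lie_e_f_pow_succ t hm.1, (mem_highestWeightSpace.1 hm).2]
    simp
  obtain ⟨n, hn⟩ := hf
  obtain ⟨j, hj⟩ := exists_eq_natCast_of_mem_highestWeightSpace t hmem h₀
    ⟨n, by rw [← Module.End.mul_apply, ← pow_add, add_comm, pow_add, Module.End.mul_apply, hn,
      map_zero]⟩
  have hsum : ((j + k + 2 : ℕ) : K) = 0 := by
    push_cast at hj ⊢
    linear_combination -hj
  exact absurd (Nat.cast_eq_zero.1 hsum) (by omega)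

end Sl2Triple

section EigenvectorInSubmodule

variable {K V : Type*} [Field K] [AddCommGroup V] [Module K V]

/- Applying `T - ν` to a vector removes its component of eigenvalue `ν`. -/
theorem exists_mem_eigenspace_of_mem_iSup_eigenspace (T : Module.End K V) {W : Submodule K V}
    (hW : ∀ w ∈ W, T w ∈ W) {m : V} (hm : m ∈ W) (hm₀ : m ≠ 0) (hmT : m ∈ ⨆ μ, T.eigenspace μ) :
    ∃ μ, ∃ w ∈ W, w ≠ 0 ∧ w ∈ T.eigenspace μ := by
  classical
  obtain ⟨S, hS⟩ := Submodule.mem_iSup_iff_exists_finset.1 hmT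
  clear hmT
  induction S using Finset.induction_on generalizing m with
  | empty => exact absurd (by simpa using hS) hm₀
  | insert ν S _ ih =>
    rw [Finset.iSup_insert] at hS
    obtain ⟨a, ha, b, hb, rfl⟩ := Submodule.mem_sup.1 hS
    by_cases hν : T (a + b) - ν • (a + b) = 0
    · exact ⟨ν, a + b, hm, hm₀, Module.End.mem_eigenspace_iff.2 (sub_eq_zero.1 hν)⟩
    · refine ih (sub_mem (hW _ hm) (W.smul_mem ν hm)) hν ?_
      have map_le : (⨆ μ ∈ S, T.eigenspace μ).map T ≤ ⨆ μ ∈ S, T.eigenspace μ := by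
        simp only [Submodule.map_iSup]
        refine iSup₂_mono fun μ _ => ?_
        rintro _ ⟨w, hw, rfl⟩
        rw [Module.End.mem_eigenspace_iff.1 hw]
        exact Submodule.smul_mem _ _ hw
      rw [map_add, Module.End.mem_eigenspace_iff.1 ha, smul_add, add_sub_add_left_eq_sub]
      exact sub_mem (map_le ⟨b, hb, rfl⟩) (Submodule.smul_mem _ _ hb)

end EigenvectorInSubmodule

section Integrable

variable {K L M N : Type*} [Field K] [LieRing L] [LieAlgebra K L] {h e f : L}
  [AddCommGroup M] [Module K M] [LieRingModule L M] [LieModule K L M]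
  [AddCommGroup N] [Module K N] [LieRingModule L N] [LieModule K L N]

variable (K M) in
/-- For an `sl₂`-triple `(h, e, f)`, the module `M` is integrable when it is spanned by weight
vectors and `e` and `f` act locally nilpotently. -/
structure IsIntegrable (h e f : L) : Prop where
  iSup_weightSpace : ⨆ μ : K, weightSpace M h μ = ⊤
  e_nilpotent (m : M) : ∃ n : ℕ, (toEnd K L M e ^ n) m = 0
  f_nilpotent (m : M) : ∃ n : ℕ, (toEnd K L M f ^ n) m = 0

namespace IsIntegrable

omit [LieModule K L N] in
theorem iSup_map_weightSpace (hM : IsIntegrable K M h e f) {φ : M →ₗ⁅K,L⁆ N}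
    (hφ : Function.Surjective φ) : ⨆ μ : K, (weightSpace M h μ).map (φ : M →ₗ[K] N) = ⊤ := by
  rw [← Submodule.map_iSup, hM.iSup_weightSpace, Submodule.map_top]
  exact LinearMap.range_eq_top.2 hφ

theorem of_surjective (hM : IsIntegrable K M h e f) {φ : M →ₗ⁅K,L⁆ N}
    (hφ : Function.Surjective φ) : IsIntegrable K N h e f where
  iSup_weightSpace := by
    rw [eq_top_iff, ← hM.iSup_map_weightSpace hφ]
    exact iSup_mono fun μ => Submodule.map_le_iff_le_comap.2 fun _ => map_mem_weightSpace φ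
  e_nilpotent q := by
    obtain ⟨m, rfl⟩ := hφ q
    obtain ⟨n, hn⟩ := hM.e_nilpotent m
    exact ⟨n, by rw [toEnd_pow_apply_map, hn, map_zero]⟩
  f_nilpotent q := by
    obtain ⟨m, rfl⟩ := hφ q
    obtain ⟨n, hn⟩ := hM.f_nilpotent m
    exact ⟨n, by rw [toEnd_pow_apply_map, hn, map_zero]⟩

theorem map_weightSpace_eq (hM : IsIntegrable K M h e f) {φ : M →ₗ⁅K,L⁆ N}
    (hφ : Function.Surjective φ) (μ : K) :
    (weightSpace M h μ).map (φ : M →ₗ[K] N) = weightSpace N h μ :=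
  congr_fun (((Module.End.eigenspaces_iSupIndep _).le_iff_eq_of_iSup_eq_top
    (hM.iSup_map_weightSpace hφ)).1 fun _ => Submodule.map_le_iff_le_comap.2 fun _ =>
      map_mem_weightSpace φ) μ

variable [CharZero K]

theorem exists_mem_highestWeightSpace (hM : IsIntegrable K M h e f) (t : IsSl2Triple h e f)
    {W : LieSubmodule K L M} (hW : W ≠ ⊥) :
    ∃ k : ℕ, ∃ m ∈ W, m ≠ 0 ∧ m ∈ highestWeightSpace M h e (k : K) := by
  obtain ⟨m, hm, hm₀⟩ := Submodule.exists_mem_ne_zero_of_ne_bot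
    (mt (LieSubmodule.toSubmodule_eq_bot W).1 hW)
  obtain ⟨μ, w, hw, hw₀, hwμ⟩ := exists_mem_eigenspace_of_mem_iSup_eigenspace (toEnd K L M h)
    (W := W) (fun _ => W.lie_mem) hm hm₀ (hM.iSup_weightSpace ▸ Submodule.mem_top)
  obtain ⟨n, hn, hn'⟩ := Nat.exists_not_and_succ_of_not_zero_of_exists
    (p := fun n => (toEnd K L M e ^ n) w = 0) hw₀ (hM.e_nilpotent w)
  rw [pow_succ', Module.End.mul_apply, toEnd_apply_apply] at hn'
  have hmem : (toEnd K L M e ^ n) w ∈ highestWeightSpace M h e (μ + n * 2) :=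
    mem_highestWeightSpace.2 ⟨mem_weightSpace.1 (e_pow_mem_weightSpace t hwμ n), hn'⟩
  obtain ⟨k, hk⟩ :=
    exists_eq_natCast_of_mem_highestWeightSpace t hmem hn (hM.f_nilpotent _)
  have hW' : (toEnd K L M e ^ n) w ∈ W :=
    W.coe_toEnd_pow K L M e ⟨w, hw⟩ n ▸ Subtype.property _
  exact ⟨k, _, hW', hn, hk ▸ hmem⟩

end IsIntegrable

end Integrable

section ExtremalProjector

variable {K L M N : Type*} [Field K] [LieRing L] [LieAlgebra K L] {h e f : L}
  [AddCommGroup M] [Module K M] [LieRingModule L M] [LieModule K L M]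
  [AddCommGroup N] [Module K N] [LieRingModule L N] [LieModule K L N]

variable (K) in
/-- The coefficients `(-1) ^ j / (j! (k + 2) (k + 3) ⋯ (k + j + 1))` of the extremal projector
`∑ j, c j • f ^ j e ^ j` on vectors of weight `k`. -/
def extremalCoeff (k : ℕ) : ℕ → K
  | 0 => 1
  | j + 1 => -extremalCoeff k j / ((j + 1) * (k + j + 2))

variable (K M) in
/-- The sum of the terms of index at most `n` of the extremal projector on vectors of weight `k`. It
maps vectors of weight `k` killed by `e ^ (n + 1)` to highest weight vectors. -/
def extremalSum (e f : L) (k n : ℕ) : Module.End K M :=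
  ∑ j ∈ Finset.range (n + 1), extremalCoeff K k j • (toEnd K L M f ^ j * toEnd K L M e ^ j)

theorem extremalSum_mem_weightSpace (t : IsSl2Triple h e f) {k : ℕ} {m : M}
    (hm : m ∈ weightSpace M h (k : K)) (n : ℕ) :
    extremalSum K M e f k n m ∈ weightSpace M h (k : K) := by
  rw [extremalSum, LinearMap.sum_apply]
  refine sum_mem fun j _ => Submodule.smul_mem _ _ ?_
  have hj := f_pow_mem_weightSpace t (e_pow_mem_weightSpace t hm j) j
  rwa [add_assoc, ← mul_add, add_neg_cancel, mul_zero, add_zero] at hj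

theorem extremalSum_of_lie_e_eq_zero {m : M} (hm : ⁅e, m⁆ = 0) (k n : ℕ) :
    extremalSum K M e f k n m = m := by
  rw [extremalSum, LinearMap.sum_apply, Finset.sum_range_succ', Finset.sum_eq_zero fun j _ => ?_,
    zero_add]
  · simp [extremalCoeff]
  · simp [pow_succ, hm]

theorem map_extremalSum (φ : M →ₗ⁅K,L⁆ N) (k n : ℕ) (m : M) :
    φ (extremalSum K M e f k n m) = extremalSum K N e f k n (φ m) := by
  simp [extremalSum, toEnd_pow_apply_map]

variable [CharZero K]

theorem lie_e_extremalSum (t : IsSl2Triple h e f) {k : ℕ} {m : M}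
    (hm : m ∈ weightSpace M h (k : K)) (n : ℕ) :
    ⁅e, extremalSum K M e f k n m⁆ =
      extremalCoeff K k n • (toEnd K L M f ^ n) ((toEnd K L M e ^ (n + 1)) m) := by
  induction n with
  | zero => simp [extremalSum, extremalCoeff]
  | succ n ih =>
    have h₁ : (n + 1 : K) ≠ 0 := Nat.cast_add_one_ne_zero n
    have h₂ : (k + n + 2 : K) ≠ 0 := by exact_mod_cast Nat.succ_ne_zero (k + n + 1)
    have cancel : extremalCoeff K k n +
        extremalCoeff K k (n + 1) * ((n + 1) * (k + (n + 1 : ℕ) * 2 - n)) = 0 := by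
      rw [extremalCoeff]
      push_cast
      field_simp
      ring
    rw [extremalSum, Finset.sum_range_succ, ← extremalSum, LinearMap.add_apply, lie_add, ih,
      LinearMap.smul_apply, Module.End.mul_apply, lie_smul,
      lie_e_f_pow_succ t (e_pow_mem_weightSpace t hm (n + 1)), smul_add, smul_smul,
      add_left_comm, ← add_smul, cancel, zero_smul, add_zero, pow_succ' _ (n + 1),
      Module.End.mul_apply, toEnd_apply_apply]

theorem IsIntegrable.exists_lift_mem_highestWeightSpace (hM : IsIntegrable K M h e f)
    (t : IsSl2Triple h e f) {φ : M →ₗ⁅K,L⁆ N} (hφ : Function.Surjective φ) {k : ℕ} {q : N}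
    (hq : q ∈ highestWeightSpace N h e (k : K)) :
    ∃ m ∈ highestWeightSpace M h e (k : K), φ m = q := by
  obtain ⟨m, hm, rfl⟩ := (hM.map_weightSpace_eq hφ (k : K)).ge hq.1
  obtain ⟨n, hn⟩ := hM.e_nilpotent m
  refine ⟨extremalSum K M e f k n m, mem_highestWeightSpace.2
    ⟨mem_weightSpace.1 (extremalSum_mem_weightSpace t hm n), ?_⟩, ?_⟩
  · rw [lie_e_extremalSum t hm, pow_succ', Module.End.mul_apply, hn, map_zero, map_zero,
      smul_zero]
  · rw [map_extremalSum]
    exact extremalSum_of_lie_e_eq_zero (mem_highestWeightSpace.1 hq).2 k n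

theorem IsIntegrable.finite_highestWeightSpace_of_surjective (hM : IsIntegrable K M h e f)
    (t : IsSl2Triple h e f) {φ : M →ₗ⁅K,L⁆ N} (hφ : Function.Surjective φ) (k : ℕ)
    [Module.Finite K (highestWeightSpace M h e (k : K))] :
    Module.Finite K (highestWeightSpace N h e (k : K)) := by
  refine Module.Finite.of_surjective
    ((φ : M →ₗ[K] N).restrict fun _ => map_mem_highestWeightSpace φ) ?_
  rintro ⟨q, hq⟩
  obtain ⟨m, hm, rfl⟩ := hM.exists_lift_mem_highestWeightSpace t hφ hq
  exact ⟨⟨m, hm⟩, rfl⟩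

end ExtremalProjector

/-! ### Finite-dimensional modules of `sl₂` and multiplicities -/

section Irreducible

variable {R L V W : Type*} [CommRing R] [LieRing L]
  [AddCommGroup V] [Module R V] [LieRingModule L V]
  [AddCommGroup W] [Module R W] [LieRingModule L W]

theorem isIrreducible_of_isAtom {N : LieSubmodule R L V} (hN : IsAtom N) :
    LieModule.IsIrreducible R L N := by
  have : Nontrivial N := (LieSubmodule.nontrivial_iff_ne_bot R L V).2 hN.1
  refine LieModule.IsIrreducible.mk fun K hK => ?_
  by_contra hK'
  refine hK (eq_bot_iff.2 ?_)
  have hmap := hN.2 _ (LieSubmodule.map_incl_lt_iff_lt_top.2 (lt_top_iff_ne_top.2 hK'))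
  rw [← N.ker_incl]
  exact fun v hv => LieModuleHom.mem_ker.2
    ((LieSubmodule.mem_bot _).1 (hmap ▸ LieSubmodule.mem_map_of_mem hv))

variable [LieModule.IsIrreducible R L V] {φ : V →ₗ⁅R,L⁆ W}

theorem isAtom_range (hφ : φ ≠ 0) : IsAtom φ.range := by
  refine ⟨fun hbot => hφ (LieModuleHom.ext fun v => ?_), fun K hK => ?_⟩
  · exact (LieSubmodule.mem_bot _).1 (hbot ▸ (LieModuleHom.mem_range φ _).2 ⟨v, rfl⟩)
  · have hmap := LieSubmodule.map_comap_eq K φ hK.le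
    rcases eq_bot_or_eq_top (K.comap φ) with hbot | htop
    · rw [← hmap, hbot, LieSubmodule.map_bot]
    · rw [htop, LieModuleHom.map_top] at hmap
      exact absurd hmap hK.ne'

/-- Schur's lemma. -/
theorem bijective_of_ne_zero [LieModule.IsIrreducible R L W] (hφ : φ ≠ 0) :
    Function.Bijective φ := by
  refine ⟨φ.ker_eq_bot.1 ((eq_bot_or_eq_top _).resolve_right fun htop => hφ ?_),
    φ.range_eq_top.1 ((eq_bot_or_eq_top _).resolve_left (isAtom_range hφ).1)⟩
  exact LieModuleHom.ext fun v => LieModuleHom.mem_ker.1 (htop ▸ LieSubmodule.mem_top v)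

end Irreducible

namespace Sl2

open LieAlgebra.SpecialLinear

/-- The raising generator of `sl₂`. -/
def e : Sl2 := single 0 1 zero_ne_one 1

/-- The lowering generator of `sl₂`. -/
def f : Sl2 := single 1 0 one_ne_zero 1

/-- The semisimple generator of `sl₂`. -/
def h : Sl2 := singleSubSingle 0 1 1

theorem apply_one_one (x : Sl2) : x.1 1 1 = -x.1 0 0 := by
  have trace_eq_zero : x.1 0 0 + x.1 1 1 = 0 := by
    simpa [LieAlgebra.SpecialLinear.sl, Matrix.trace_fin_two] using x.2
  linear_combination trace_eq_zero

theorem eq_smul_add_smul_add_smul (x : Sl2) :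
    x = x.1 0 0 • h + x.1 0 1 • e + x.1 1 0 • f := by
  ext i j
  fin_cases i <;> fin_cases j <;> simp [h, e, f, apply_one_one]

theorem isSl2Triple : IsSl2Triple h e f where
  h_ne_zero h₀ := by simpa [h] using congrFun₂ (congrArg Subtype.val h₀) 0 0
  lie_e_f := by
    ext i j
    fin_cases i <;> fin_cases j <;> simp [h, e, f, Ring.lie_def]
  lie_h_e_nsmul := by
    ext i j
    fin_cases i <;> fin_cases j <;> simp [h, e, Ring.lie_def]
    norm_num
  lie_h_f_nsmul := by
    ext i j
    fin_cases i <;> fin_cases j <;> simp [h, f, Ring.lie_def]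
    norm_num

section

variable {M N : Type*} [AddCommGroup M] [Module ℂ M] [LieRingModule Sl2 M] [LieModule ℂ Sl2 M]
  [AddCommGroup N] [Module ℂ N] [LieRingModule Sl2 N] [LieModule ℂ Sl2 N]

/-- A linear map between `sl₂`-modules commuting with `e` and `f`, as a homomorphism of
`sl₂`-modules. -/
def homOfCommute (φ : M →ₗ[ℂ] N) (he : ∀ m, φ ⁅e, m⁆ = ⁅e, φ m⁆)
    (hf : ∀ m, φ ⁅f, m⁆ = ⁅f, φ m⁆) : M →ₗ⁅ℂ,Sl2⁆ N where
  __ := φ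
  map_lie' {x m} := by
    change φ ⁅x, m⁆ = ⁅x, φ m⁆
    rw [eq_smul_add_smul_add_smul x, ← isSl2Triple.lie_e_f]
    simp only [add_lie, smul_lie, lie_lie, map_add, map_sub, map_smul, he, hf]

end

end Sl2

namespace Irrep

variable {n : ℕ}

instance : Module.Finite ℂ (Irrep n) := inferInstanceAs (Module.Finite ℂ (Fin (n + 1) → ℂ))

theorem coord_of_le (w : Irrep n) {j : ℕ} (hj : n + 1 ≤ j) : coord w j = 0 :=
  dif_neg (not_lt.2 hj)

theorem ext_coord {v w : Irrep n} (hvw : ∀ j ≤ n, coord v j = coord w j) : v = w := by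
  funext ⟨j, hj⟩
  simpa [coord, hj] using hvw j (Nat.lt_succ_iff.1 hj)

theorem coord_zero (j : ℕ) : coord (0 : Irrep n) j = 0 := by
  simpa using coord_smul n 0 (0 : Irrep n) j

theorem coord_lie (x : Sl2) (w : Irrep n) {j : ℕ} (hj : j < n + 1) :
    coord ⁅x, w⁆ j = x.1 0 0 * (((n : ℂ) - 2 * j) * coord w j)
      + x.1 0 1 * (((n : ℂ) - j) * coord w (j + 1)) + x.1 1 0 * (j * coord w (j - 1)) :=
  coord_act n x w j hj

theorem coord_lie_e (w : Irrep n) (j : ℕ) :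
    coord ⁅Sl2.e, w⁆ j = ((n : ℂ) - j) * coord w (j + 1) := by
  rcases Nat.lt_or_ge j (n + 1) with hj | hj
  · simp [coord_lie _ w hj, Sl2.e]
  · rw [coord_of_le _ hj, coord_of_le _ (hj.trans (Nat.le_succ j)), mul_zero]

theorem coord_lie_f_zero (w : Irrep n) : coord ⁅Sl2.f, w⁆ 0 = 0 := by
  simp [coord_lie _ w (Nat.succ_pos n), Sl2.f]

theorem coord_lie_f_succ (w : Irrep n) {j : ℕ} (hj : j < n) :
    coord ⁅Sl2.f, w⁆ (j + 1) = ((j : ℂ) + 1) * coord w j := by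
  simp [coord_lie _ w (Nat.succ_lt_succ hj), Sl2.f]

theorem coord_lie_h (w : Irrep n) {j : ℕ} (hj : j < n + 1) :
    coord ⁅Sl2.h, w⁆ j = ((n : ℂ) - 2 * j) * coord w j := by
  simp [coord_lie _ w hj, Sl2.h]

variable (n) in
/-- The basis vector `v_{n - 2j}` of `L(n)`, read as zero for `j > n`. -/
def vec (j : ℕ) : Irrep n := fun i => if i.1 = j then 1 else 0

theorem coord_vec {i : ℕ} (hi : i ≤ n) (j : ℕ) : coord (vec n j) i = if i = j then 1 else 0 := by
  rw [coord, dif_pos (Nat.lt_succ_iff.2 hi)]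
  rfl

theorem vec_eq_single (j : Fin (n + 1)) :
    vec n j = (Pi.single j 1 : Fin (n + 1) → ℂ) := by
  funext i
  exact (if_congr Fin.ext_iff.symm rfl rfl).trans (Pi.single_apply j (1 : ℂ) i).symm

theorem eq_sum_vec (w : Irrep n) : w = ∑ j : Fin (n + 1), w j • vec n j := by
  refine (pi_eq_sum_univ' (R := ℂ) (w : Fin (n + 1) → ℂ)).trans ?_
  exact Finset.sum_congr rfl fun j _ => congrArg (w j • ·) (vec_eq_single j).symm

theorem vec_zero_ne_zero : vec n 0 ≠ 0 := fun h₀ => by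
  simpa [coord_vec, coord_zero] using congrArg (fun w => coord w 0) h₀

theorem vec_zero_mem_highestWeightSpace :
    vec n 0 ∈ highestWeightSpace (Irrep n) Sl2.h Sl2.e (n : ℂ) := by
  refine mem_highestWeightSpace.2 ⟨ext_coord fun j hj => ?_, ext_coord fun j hj => ?_⟩
  · rw [coord_lie_h _ (Nat.lt_succ_iff.2 hj), coord_smul, coord_vec hj]
    rcases eq_or_ne j 0 with rfl | hj₀ <;> simp [*]
  · rw [coord_lie_e, coord_zero]
    rcases hj.eq_or_lt with rfl | hj
    · rw [sub_self, zero_mul]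
    · rw [coord_vec hj, if_neg (Nat.succ_ne_zero j), mul_zero]

theorem eq_smul_vec_zero_of_lie_e_eq_zero {w : Irrep n} (hw : ⁅Sl2.e, w⁆ = 0) :
    w = coord w 0 • vec n 0 := by
  refine ext_coord fun j hj => ?_
  rw [coord_smul, coord_vec hj]
  rcases j with _ | j
  · simp
  · have h₀ := coord_lie_e w j
    rw [hw, coord_zero, zero_eq_mul, sub_eq_zero, Nat.cast_inj] at h₀
    simpa using h₀.resolve_left (Nat.lt_of_succ_le hj).ne'

theorem lie_f_vec (j : ℕ) : ⁅Sl2.f, vec n j⁆ = ((j : ℂ) + 1) • vec n (j + 1) := by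
  refine ext_coord fun i hi => ?_
  rw [coord_smul, coord_vec hi]
  rcases i with _ | i
  · simp [coord_lie_f_zero]
  · rw [coord_lie_f_succ _ (Nat.lt_of_succ_le hi), coord_vec (Nat.le_of_succ_le hi)]
    rcases eq_or_ne i j with rfl | hij <;> simp [*]

theorem lie_e_vec_zero : ⁅Sl2.e, vec n 0⁆ = 0 :=
  (mem_highestWeightSpace.1 vec_zero_mem_highestWeightSpace).2

theorem lie_e_vec_succ (j : ℕ) : ⁅Sl2.e, vec n (j + 1)⁆ = ((n : ℂ) - j) • vec n j := by
  refine ext_coord fun i hi => ?_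
  rw [coord_smul, coord_lie_e, coord_vec hi]
  rcases hi.eq_or_lt with rfl | hi
  · rcases eq_or_ne i j with rfl | hij <;> simp [*]
  · rw [coord_vec hi]
    rcases eq_or_ne i j with rfl | hij <;> simp [*]

theorem lie_h_vec (j : ℕ) : ⁅Sl2.h, vec n j⁆ = ((n : ℂ) - 2 * j) • vec n j := by
  refine ext_coord fun i hi => ?_
  rw [coord_smul, coord_lie_h _ (Nat.lt_succ_iff.2 hi), coord_vec hi]
  rcases eq_or_ne i j with rfl | hij <;> simp [*]

theorem e_pow_succ_eq_zero : toEnd ℂ Sl2 (Irrep n) Sl2.e ^ (n + 1) = 0 := by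
  have coord_e_pow (w : Irrep n) (k : ℕ) :
      ∀ j, n < j + k → coord ((toEnd ℂ Sl2 (Irrep n) Sl2.e ^ k) w) j = 0 := by
    induction k with
    | zero => exact fun j hj => coord_of_le w hj
    | succ k ih =>
      intro j hj
      rw [pow_succ', Module.End.mul_apply, toEnd_apply_apply, coord_lie_e, ih _ (by omega),
        mul_zero]
  refine LinearMap.ext fun w => ext_coord fun j _ => ?_
  rw [coord_e_pow w (n + 1) j (by omega), LinearMap.zero_apply, coord_zero]

theorem f_pow_succ_eq_zero : toEnd ℂ Sl2 (Irrep n) Sl2.f ^ (n + 1) = 0 := by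
  have coord_f_pow (w : Irrep n) (k : ℕ) :
      ∀ j < k, j ≤ n → coord ((toEnd ℂ Sl2 (Irrep n) Sl2.f ^ k) w) j = 0 := by
    induction k with
    | zero => exact fun j hj => absurd hj j.not_lt_zero
    | succ k ih =>
      intro j hj hjn
      rw [pow_succ', Module.End.mul_apply, toEnd_apply_apply]
      rcases j with _ | j
      · exact coord_lie_f_zero _
      · rw [coord_lie_f_succ _ hjn, ih j (by omega) (by omega), mul_zero]
  refine LinearMap.ext fun w => ext_coord fun j hj => ?_
  rw [coord_f_pow w (n + 1) j (by omega) hj, LinearMap.zero_apply, coord_zero]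

theorem eq_top_of_vec_zero_mem {K : LieSubmodule ℂ Sl2 (Irrep n)} (hK : vec n 0 ∈ K) : K = ⊤ := by
  have vec_mem (j : ℕ) : vec n j ∈ K := by
    induction j with
    | zero => exact hK
    | succ j ih =>
      have hj := K.smul_mem ((j : ℂ) + 1)⁻¹ (K.lie_mem (x := Sl2.f) ih)
      rwa [lie_f_vec, inv_smul_smul₀ (Nat.cast_add_one_ne_zero j)] at hj
  refine eq_top_iff.2 fun w _ => ?_
  rw [eq_sum_vec w]
  exact sum_mem fun j _ => K.smul_mem _ (vec_mem j)

instance isIrreducible : LieModule.IsIrreducible ℂ Sl2 (Irrep n) := by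
  have : Nontrivial (Irrep n) := ⟨_, _, vec_zero_ne_zero⟩
  refine LieModule.IsIrreducible.mk fun K hK => ?_
  obtain ⟨w, hw, hw₀⟩ := Submodule.exists_mem_ne_zero_of_ne_bot
    (mt (LieSubmodule.toSubmodule_eq_bot K).1 hK)
  obtain ⟨j, hj, hj'⟩ := Nat.exists_not_and_succ_of_not_zero_of_exists
    (p := fun j => (toEnd ℂ Sl2 (Irrep n) Sl2.e ^ j) w = 0) hw₀
    ⟨n + 1, by rw [e_pow_succ_eq_zero, LinearMap.zero_apply]⟩
  rw [pow_succ', Module.End.mul_apply, toEnd_apply_apply] at hj'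
  have hjK : (toEnd ℂ Sl2 (Irrep n) Sl2.e ^ j) w ∈ K :=
    K.coe_toEnd_pow ℂ Sl2 _ Sl2.e ⟨w, hw⟩ j ▸ Subtype.property _
  rw [eq_smul_vec_zero_of_lie_e_eq_zero hj'] at hj hjK
  exact eq_top_of_vec_zero_mem ((Submodule.smul_mem_iff _ (left_ne_zero_of_smul hj)).1 hjK)

end Irrep

section FromIrrep

variable {M : Type*} [AddCommGroup M] [Module ℂ M] [LieRingModule Sl2 M] [LieModule ℂ Sl2 M]
  {k : ℕ} {m : M}

/-- The linear map `L(k) → M` with `v_{k - 2j} ↦ f ^ j m / j!`. -/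
def fromIrrepLinear (k : ℕ) (m : M) : Irrep k →ₗ[ℂ] M where
  toFun w := ∑ j ∈ Finset.range (k + 1),
    (Irrep.coord w j / j.factorial) • (toEnd ℂ Sl2 M Sl2.f ^ j) m
  map_add' v w := by
    simp only [Irrep.coord_add, add_div, add_smul, Finset.sum_add_distrib]
  map_smul' c w := by
    simp only [Irrep.coord_smul, mul_div_assoc, mul_smul, Finset.smul_sum, RingHom.id_apply]

theorem fromIrrepLinear_apply (w : Irrep k) :
    fromIrrepLinear k m w = ∑ j ∈ Finset.range (k + 1),
      (Irrep.coord w j / j.factorial) • (toEnd ℂ Sl2 M Sl2.f ^ j) m := rfl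

theorem fromIrrepLinear_lie_e (hm : m ∈ highestWeightSpace M Sl2.h Sl2.e (k : ℂ)) (w : Irrep k) :
    fromIrrepLinear k m ⁅Sl2.e, w⁆ = ⁅Sl2.e, fromIrrepLinear k m w⁆ := by
  have he := (mem_highestWeightSpace.1 hm).2
  rw [fromIrrepLinear_apply, fromIrrepLinear_apply, lie_sum, Finset.sum_range_succ,
    Finset.sum_range_succ', Irrep.coord_lie_e, sub_self, zero_mul, zero_div, zero_smul, add_zero,
    pow_zero, Module.End.one_apply, lie_smul, he, smul_zero, add_zero]
  refine Finset.sum_congr rfl fun j _ => ?_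
  rw [lie_smul, lie_e_f_pow_succ Sl2.isSl2Triple hm.1, he, map_zero, zero_add, smul_smul,
    Irrep.coord_lie_e, Nat.factorial_succ]
  have hj : (j + 1 : ℂ) ≠ 0 := Nat.cast_add_one_ne_zero j
  congr 1
  push_cast
  field_simp

theorem fromIrrepLinear_lie_f (hm : (toEnd ℂ Sl2 M Sl2.f ^ (k + 1)) m = 0) (w : Irrep k) :
    fromIrrepLinear k m ⁅Sl2.f, w⁆ = ⁅Sl2.f, fromIrrepLinear k m w⁆ := by
  have lie_f_pow (j : ℕ) : ⁅Sl2.f, (toEnd ℂ Sl2 M Sl2.f ^ j) m⁆ =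
      (toEnd ℂ Sl2 M Sl2.f ^ (j + 1)) m := by
    rw [pow_succ', Module.End.mul_apply, toEnd_apply_apply]
  rw [fromIrrepLinear_apply, fromIrrepLinear_apply, lie_sum, Finset.sum_range_succ',
    Finset.sum_range_succ, Irrep.coord_lie_f_zero, zero_div, zero_smul, add_zero, lie_smul,
    lie_f_pow, hm, smul_zero, add_zero]
  refine Finset.sum_congr rfl fun j hj => ?_
  rw [lie_smul, lie_f_pow, Irrep.coord_lie_f_succ _ (Finset.mem_range.1 hj), Nat.factorial_succ]
  have hj : (j + 1 : ℂ) ≠ 0 := Nat.cast_add_one_ne_zero j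
  congr 1
  push_cast
  field_simp

/-- The homomorphism `L(k) → M` mapping `v_k` to a highest weight vector of weight `k` killed by
`f ^ (k + 1)`. -/
def fromIrrep (hm : m ∈ highestWeightSpace M Sl2.h Sl2.e (k : ℂ))
    (hf : (toEnd ℂ Sl2 M Sl2.f ^ (k + 1)) m = 0) : Irrep k →ₗ⁅ℂ,Sl2⁆ M :=
  Sl2.homOfCommute (fromIrrepLinear k m) (fromIrrepLinear_lie_e hm) (fromIrrepLinear_lie_f hf)

theorem fromIrrep_vec_zero (hm : m ∈ highestWeightSpace M Sl2.h Sl2.e (k : ℂ))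
    (hf : (toEnd ℂ Sl2 M Sl2.f ^ (k + 1)) m = 0) : fromIrrep hm hf (Irrep.vec k 0) = m := by
  change fromIrrepLinear k m (Irrep.vec k 0) = m
  rw [fromIrrepLinear_apply, Finset.sum_range_succ', Finset.sum_eq_zero fun j hj => ?_]
  · simp [Irrep.coord_vec]
  · rw [Irrep.coord_vec (Finset.mem_range.1 hj), if_neg (Nat.succ_ne_zero j), zero_div, zero_smul]

theorem exists_irrepHom (hm : m ∈ highestWeightSpace M Sl2.h Sl2.e (k : ℂ)) (hm₀ : m ≠ 0)
    (hf : ∃ n, (toEnd ℂ Sl2 M Sl2.f ^ n) m = 0) :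
    ∃ φ : Irrep k →ₗ⁅ℂ,Sl2⁆ M, φ ≠ 0 ∧ φ (Irrep.vec k 0) = m := by
  have hf' := f_pow_succ_eq_zero_of_mem_highestWeightSpace Sl2.isSl2Triple hm hf
  have hvec := fromIrrep_vec_zero hm hf'
  exact ⟨fromIrrep hm hf', fun h₀ => hm₀ (by rw [← hvec, h₀, LieModuleHom.zero_apply]), hvec⟩

section

variable [LieModule.IsIrreducible ℂ Sl2 M] (hm : m ∈ highestWeightSpace M Sl2.h Sl2.e (k : ℂ))
  (hm₀ : m ≠ 0) (hf : ∃ n, (toEnd ℂ Sl2 M Sl2.f ^ n) m = 0)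
include hm hm₀ hf

theorem nonempty_equiv_irrep : Nonempty (M ≃ₗ⁅ℂ,Sl2⁆ Irrep k) := by
  obtain ⟨φ, hφ, -⟩ := exists_irrepHom hm hm₀ hf
  let ε := LinearEquiv.ofBijective (φ : Irrep k →ₗ[ℂ] M) (bijective_of_ne_zero hφ)
  let ψ : Irrep k ≃ₗ⁅ℂ,Sl2⁆ M :=
    { φ with
      invFun := ε.symm
      left_inv := ε.left_inv
      right_inv := ε.right_inv }
  exact ⟨ψ.symm⟩

theorem mem_span_singleton_of_lie_e_eq_zero {m' : M} (he : ⁅Sl2.e, m'⁆ = 0) :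
    m' ∈ Submodule.span ℂ {m} := by
  obtain ⟨φ, hφ, rfl⟩ := exists_irrepHom hm hm₀ hf
  obtain ⟨hinj, hsurj⟩ := bijective_of_ne_zero hφ
  obtain ⟨w, rfl⟩ := hsurj m'
  rw [← LieModuleHom.map_lie, ← map_zero φ] at he
  rw [Irrep.eq_smul_vec_zero_of_lie_e_eq_zero (hinj he), map_smul]
  exact Submodule.smul_mem _ _ (Submodule.mem_span_singleton_self _)

end

end FromIrrep

section Decomposition

variable {M : Type*} [AddCommGroup M] [Module ℂ M] [LieRingModule Sl2 M] [LieModule ℂ Sl2 M]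

namespace IsIntegrable

theorem f_nilpotent_coe (hM : IsIntegrable ℂ M Sl2.h Sl2.e Sl2.f) (W : LieSubmodule ℂ Sl2 M)
    (w : W) : ∃ n, (toEnd ℂ Sl2 W Sl2.f ^ n) w = 0 := by
  obtain ⟨n, hn⟩ := hM.f_nilpotent w
  exact ⟨n, Subtype.ext ((W.coe_toEnd_pow ℂ Sl2 M Sl2.f w n).trans hn)⟩

theorem exists_equiv_irrep (hM : IsIntegrable ℂ M Sl2.h Sl2.e Sl2.f) (W : LieSubmodule ℂ Sl2 M)
    [LieModule.IsIrreducible ℂ Sl2 W] : ∃ k : ℕ, Nonempty (W ≃ₗ⁅ℂ,Sl2⁆ Irrep k) := by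
  have hW : W ≠ ⊥ := (LieSubmodule.nontrivial_iff_ne_bot ℂ Sl2 M).1
    (LieModule.nontrivial_of_isIrreducible ℂ Sl2 W)
  obtain ⟨k, m, hmW, hm₀, hm⟩ := hM.exists_mem_highestWeightSpace Sl2.isSl2Triple hW
  have hm' : (⟨m, hmW⟩ : W) ∈ highestWeightSpace W Sl2.h Sl2.e (k : ℂ) :=
    (map_mem_highestWeightSpace_iff W.injective_incl).1 hm
  exact ⟨k, nonempty_equiv_irrep hm' (fun h₀ => hm₀ (congrArg Subtype.val h₀))
    (hM.f_nilpotent_coe W _)⟩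

theorem sSup_atoms_eq_top (hM : IsIntegrable ℂ M Sl2.h Sl2.e Sl2.f) :
    sSup {W : LieSubmodule ℂ Sl2 M | IsAtom W} = ⊤ := by
  set S := sSup {W : LieSubmodule ℂ Sl2 M | IsAtom W}
  by_contra hS
  have hπ := LieSubmodule.Quotient.surjective_mk' S
  have hne : (⊤ : LieSubmodule ℂ Sl2 (M ⧸ S)) ≠ ⊥ := fun htop => hS <| eq_top_iff.2 fun m _ =>
    (LieSubmodule.Quotient.mk_eq_zero S).1 ((LieSubmodule.mem_bot _).1
      (htop ▸ LieSubmodule.mem_top (LieSubmodule.Quotient.mk' S m)))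
  obtain ⟨k, q, -, hq₀, hq⟩ :=
    (hM.of_surjective hπ).exists_mem_highestWeightSpace Sl2.isSl2Triple hne
  obtain ⟨m, hm, rfl⟩ := hM.exists_lift_mem_highestWeightSpace Sl2.isSl2Triple hπ hq
  obtain ⟨φ, hφ, rfl⟩ := exists_irrepHom hm (fun h₀ => hq₀ (h₀ ▸ map_zero _)) (hM.f_nilpotent m)
  have hle : φ.range ≤ S := le_sSup (isAtom_range hφ)
  exact hq₀ ((LieSubmodule.Quotient.mk_eq_zero S).2 (hle ((LieModuleHom.mem_range φ _).2 ⟨_, rfl⟩)))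

end IsIntegrable

end Decomposition

section Multiplicity

variable {M : Type} [AddCommGroup M] [Module ℂ M] [LieRingModule Sl2 M] [LieModule ℂ Sl2 M]
  {s : Set (LieSubmodule ℂ Sl2 M)}

theorem IsIntegrable.exists_isSimpleDecomposition (hM : IsIntegrable ℂ M Sl2.h Sl2.e Sl2.f) :
    ∃ s : Set (LieSubmodule ℂ Sl2 M), IsSimpleDecomposition s := by
  obtain ⟨s, hind, htop, hat⟩ := exists_sSupIndep_of_sSup_atoms_eq_top hM.sSup_atoms_eq_top
  refine ⟨s, fun N hN => isIrreducible_of_isAtom (hat hN), fun N hN => ?_, hind, htop⟩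
  have := isIrreducible_of_isAtom (hat hN)
  obtain ⟨k, ⟨ε⟩⟩ := hM.exists_equiv_irrep N
  exact Module.Finite.equiv ε.toLinearEquiv.symm

namespace IsSimpleDecomposition

theorem iSupIndep_toSubmodule (hs : IsSimpleDecomposition s) :
    iSupIndep fun W : s => W.1.toSubmodule :=
  LieSubmodule.iSupIndep_toSubmodule.2 ((sSupIndep_iff _).1 hs.indep)

theorem iSup_toSubmodule (hs : IsSimpleDecomposition s) : ⨆ W : s, W.1.toSubmodule = ⊤ := by
  rw [← LieSubmodule.iSup_toSubmodule, ← sSup_eq_iSup', hs.sSup_eq_top,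
    LieSubmodule.top_toSubmodule]

theorem exists_sum_mem_highestWeightSpace (hs : IsSimpleDecomposition s) {μ : ℂ} {m : M}
    (hm : m ∈ highestWeightSpace M Sl2.h Sl2.e μ) :
    ∃ g : s →₀ M, (∀ W ∈ g.support, g W ∈ W.1 ∧ g W ∈ highestWeightSpace M Sl2.h Sl2.e μ) ∧
      ∑ W ∈ g.support, g W = m := by
  obtain ⟨g, hg, rfl⟩ := (Submodule.mem_iSup_iff_exists_finsupp _ _).1
    (hs.iSup_toSubmodule ▸ Submodule.mem_top (x := m))
  have hind := (iSupIndep_iff_finsetSum_eq_zero_imp_eq_zero _).1 hs.iSupIndep_toSubmodule g.support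
  obtain ⟨hh, he⟩ := mem_highestWeightSpace.1 hm
  refine ⟨g, fun W hW => ⟨hg W, mem_highestWeightSpace.2 ⟨sub_eq_zero.1 ?_, ?_⟩⟩, rfl⟩
  · refine hind (fun V => ⁅Sl2.h, g V⁆ - μ • g V)
      (fun V _ => sub_mem (V.1.lie_mem (hg V)) (V.1.smul_mem μ (hg V))) ?_ W hW
    rw [Finset.sum_sub_distrib, ← lie_sum, ← Finset.smul_sum, sub_eq_zero]
    exact hh
  · exact hind (fun V => ⁅Sl2.e, g V⁆) (fun V _ => V.1.lie_mem (hg V))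
      ((lie_sum _ _ _).symm.trans he) W hW

variable {k : ℕ} {v : summandsOfType s (Irrep k) → M}

theorem linearIndependent_summandsOfType (hs : IsSimpleDecomposition s) (hvW : ∀ W, v W ∈ W.1)
    (hv₀ : ∀ W, v W ≠ 0) : LinearIndependent ℂ v := by
  have hinj : Function.Injective fun W : summandsOfType s (Irrep k) => (⟨W.1, W.2.1⟩ : s) :=
    fun V W hVW => Subtype.ext (congrArg (fun x : s => x.1) hVW)
  exact (hs.iSupIndep_toSubmodule.comp hinj).linearIndependent _ hvW hv₀

theorem span_range_eq_highestWeightSpace (hM : IsIntegrable ℂ M Sl2.h Sl2.e Sl2.f)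
    (hs : IsSimpleDecomposition s) (hvW : ∀ W, v W ∈ W.1) (hv₀ : ∀ W, v W ≠ 0)
    (hv : ∀ W, v W ∈ highestWeightSpace M Sl2.h Sl2.e (k : ℂ)) :
    Submodule.span ℂ (Set.range v) = highestWeightSpace M Sl2.h Sl2.e (k : ℂ) := by
  refine le_antisymm (Submodule.span_le.2 (Set.range_subset_iff.2 hv)) fun m hm => ?_
  obtain ⟨g, hg, rfl⟩ := hs.exists_sum_mem_highestWeightSpace hm
  refine sum_mem fun W hW => ?_
  obtain ⟨hgW, hg'⟩ := hg W hW
  have := hs.irreducible W.1 W.2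
  have mem_coe {m : M} (hmW : m ∈ W.1) (hm : m ∈ highestWeightSpace M Sl2.h Sl2.e (k : ℂ)) :
      (⟨m, hmW⟩ : W.1) ∈ highestWeightSpace W.1 Sl2.h Sl2.e (k : ℂ) :=
    (map_mem_highestWeightSpace_iff W.1.injective_incl).1 hm
  have hW' : W.1 ∈ summandsOfType s (Irrep k) := ⟨W.2, nonempty_equiv_irrep (mem_coe hgW hg')
    (fun h₀ => Finsupp.mem_support_iff.1 hW (congrArg Subtype.val h₀)) (hM.f_nilpotent_coe _ _)⟩
  obtain ⟨c, hc⟩ := Submodule.mem_span_singleton.1 <| mem_span_singleton_of_lie_e_eq_zero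
    (mem_coe (hvW ⟨W, hW'⟩) (hv _)) (fun h₀ => hv₀ _ (congrArg Subtype.val h₀))
    (hM.f_nilpotent_coe _ _) (mem_highestWeightSpace.1 (mem_coe hgW hg')).2
  rw [← show c • v ⟨W, hW'⟩ = g W from congrArg Subtype.val hc]
  exact Submodule.smul_mem _ _ (Submodule.subset_span ⟨_, rfl⟩)

theorem finite_and_ncard_summandsOfType (hM : IsIntegrable ℂ M Sl2.h Sl2.e Sl2.f)
    (hs : IsSimpleDecomposition s) (k : ℕ)
    [Module.Finite ℂ (highestWeightSpace M Sl2.h Sl2.e (k : ℂ))] :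
    (summandsOfType s (Irrep k)).Finite ∧ (summandsOfType s (Irrep k)).ncard =
      Module.finrank ℂ (highestWeightSpace M Sl2.h Sl2.e (k : ℂ)) := by
  have exists_mem (W : summandsOfType s (Irrep k)) :
      ∃ m ∈ W.1, m ≠ 0 ∧ m ∈ highestWeightSpace M Sl2.h Sl2.e (k : ℂ) := by
    obtain ⟨W, -, ⟨ε⟩⟩ := W
    refine ⟨ε.symm (Irrep.vec k 0), Subtype.property _,
      fun h₀ => Irrep.vec_zero_ne_zero (n := k) ?_,
      map_mem_highestWeightSpace (W.incl.comp ε.symm.toLieModuleHom)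
        Irrep.vec_zero_mem_highestWeightSpace⟩
    rw [← ε.apply_symm_apply (Irrep.vec k 0),
      show ε.symm (Irrep.vec k 0) = 0 from Subtype.ext h₀]
    exact map_zero ε.toLieModuleHom
  choose v hvW hv₀ hv using exists_mem
  let b := (Module.Basis.span (hs.linearIndependent_summandsOfType hvW hv₀)).map
    (LinearEquiv.ofEq _ _ (hs.span_range_eq_highestWeightSpace hM hvW hv₀ hv))
  exact ⟨Module.Finite.finite_basis b, (Module.finrank_eq_nat_card_basis b).symm⟩

end IsSimpleDecomposition

theorem IsIntegrable.exists_isSimpleDecomposition_finite (hM : IsIntegrable ℂ M Sl2.h Sl2.e Sl2.f)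
    (hfin : ∀ k : ℕ, Module.Finite ℂ (highestWeightSpace M Sl2.h Sl2.e (k : ℂ))) :
    ∃ s : Set (LieSubmodule ℂ Sl2 M), IsSimpleDecomposition s ∧
      ∀ W ∈ s, (summandsOfType s W).Finite := by
  obtain ⟨s, hs⟩ := hM.exists_isSimpleDecomposition
  refine ⟨s, hs, fun W hW => ?_⟩
  have := hs.irreducible W hW
  obtain ⟨k, ⟨ε⟩⟩ := hM.exists_equiv_irrep W
  have := hfin k
  exact (hs.finite_and_ncard_summandsOfType hM k).1.subset
    fun V hV => ⟨hV.1, ⟨hV.2.some.trans ε⟩⟩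

end Multiplicity

/-! ### The symmetric algebra model of `Q(0)` -/

section Symmetric

open MvPolynomial

/-- The symmetric algebra of `L(n)`, the variable `X j` being the basis vector `v_{n - 2j}`. -/
abbrev SymAlg (n : ℕ) : Type := MvPolynomial (Fin (n + 1)) ℂ

variable {n : ℕ}

/-- The inclusion of `L(n)` in its symmetric algebra. -/
def linForm : Irrep n →ₗ[ℂ] SymAlg n := Fintype.linearCombination ℂ X

theorem linForm_vec (j : Fin (n + 1)) : linForm (Irrep.vec n j) = X j := by
  rw [Irrep.vec_eq_single]
  exact (Fintype.linearCombination_apply_single ℂ X j 1).trans (one_smul ℂ _)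

/-- The action of `sl₂` on the symmetric algebra of `L(n)` by derivations. -/
def symDerivation : Sl2 →ₗ⁅ℂ⁆ Derivation ℂ (SymAlg n) (SymAlg n) :=
  have derivation_linForm (x : Sl2) (w : Irrep n) :
      mkDerivation ℂ (fun j : Fin (n + 1) => linForm ⁅x, Irrep.vec n j⁆) (linForm w) =
        linForm ⁅x, w⁆ := by
    rw [w.eq_sum_vec]
    simp only [map_sum, map_smul, Derivation.map_smul, lie_sum, lie_smul, linForm_vec,
      mkDerivation_X]
  { toFun x := mkDerivation ℂ fun j : Fin (n + 1) => linForm ⁅x, Irrep.vec n j⁆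
    map_add' x y := derivation_ext fun j => by
      simp only [Derivation.add_apply, mkDerivation_X, add_lie, map_add]
    map_smul' c x := derivation_ext fun j => by
      simp only [RingHom.id_apply, Derivation.smul_apply, mkDerivation_X, smul_lie, map_smul]
    map_lie' {x y} := derivation_ext fun j => by
      simp only [Derivation.commutator_apply, mkDerivation_X, derivation_linForm, lie_lie,
        map_sub] }

theorem symDerivation_X (x : Sl2) (j : Fin (n + 1)) :
    symDerivation x (X j : SymAlg n) = linForm ⁅x, Irrep.vec n j⁆ :=
  mkDerivation_X _ _ _

theorem symDerivation_linForm (x : Sl2) (w : Irrep n) :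
    symDerivation x (linForm w) = linForm ⁅x, w⁆ := by
  rw [w.eq_sum_vec]
  simp only [map_sum, map_smul, Derivation.map_smul, lie_sum, lie_smul, linForm_vec,
    symDerivation_X]

instance : LieRingModule (Galilei n) (SymAlg n) where
  bracket x p := linForm x.left * p + symDerivation x.right p
  add_lie x y p := by
    change linForm (x.left + y.left) * p + symDerivation (x.right + y.right) p = _
    rw [map_add, map_add, Derivation.add_apply]
    ring
  lie_add x p q := by
    rw [map_add]
    ring
  leibniz_lie x y p := by
    change linForm x.left * (linForm y.left * p + symDerivation y.right p) +
      symDerivation x.right (linForm y.left * p + symDerivation y.right p) =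
      linForm (0 + ⁅x.right, y.left⁆ - ⁅y.right, x.left⁆) * p + symDerivation ⁅x.right, y.right⁆ p +
      (linForm y.left * (linForm x.left * p + symDerivation x.right p) +
        symDerivation y.right (linForm x.left * p + symDerivation x.right p))
    simp only [zero_add, map_sub, map_add, LieHom.map_lie, Derivation.commutator_apply,
      Derivation.leibniz, symDerivation_linForm, smul_eq_mul]
    ring

theorem galilei_lie_def (x : Galilei n) (p : SymAlg n) :
    ⁅x, p⁆ = linForm x.left * p + symDerivation x.right p := rfl

instance : LieModule ℂ (Galilei n) (SymAlg n) where
  smul_lie c x p := by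
    change linForm (c • x.left) * p + symDerivation (c • x.right) p =
      c • (linForm x.left * p + symDerivation x.right p)
    rw [map_smul, map_smul, Derivation.smul_apply, smul_add, smul_mul_assoc]
  lie_smul c x p := by
    rw [galilei_lie_def, galilei_lie_def, Derivation.map_smul, smul_add, mul_smul_comm]

instance : LieRingModule Sl2 (SymAlg n) := LieRingModule.compLieHom _ (sl2Incl n)

instance : LieModule ℂ Sl2 (SymAlg n) := LieModule.compLieHom _ (sl2Incl n)

theorem sl2_lie_eq (x : Sl2) (p : SymAlg n) : ⁅x, p⁆ = symDerivation x p := by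
  change linForm 0 * p + symDerivation x p = _
  rw [map_zero, zero_mul, zero_add]

theorem inl_lie_eq (w : Irrep n) (p : SymAlg n) :
    ⁅LieAlgebra.SemiDirectSum.inl (Irrep.derivation n) w, p⁆ = linForm w * p := by
  change linForm w * p + symDerivation 0 p = _
  rw [map_zero, Derivation.zero_apply, add_zero]

end Symmetric

section Enveloping

variable {R L : Type*} [CommRing R] [LieRing L] [LieAlgebra R L]

open UniversalEnvelopingAlgebra (ι lift)

local notation "𝒰" => UniversalEnvelopingAlgebra

attribute [local instance] LieRing.ofAssociativeRing

theorem ι_lie (x y : L) : (ι R ⁅x, y⁆ : 𝒰 R L) = ι R x * ι R y - ι R y * ι R x :=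
  (ι R).map_lie x y

theorem adjoin_range_ι : Algebra.adjoin R (Set.range (ι R : L → 𝒰 R L)) = ⊤ := by
  set A := Algebra.adjoin R (Set.range (ι R : L → 𝒰 R L))
  let j : L →ₗ⁅R⁆ A :=
    { toFun x := ⟨ι R x, Algebra.subset_adjoin ⟨x, rfl⟩⟩
      map_add' x y := Subtype.ext (map_add (ι R) x y)
      map_smul' c x := Subtype.ext (map_smul (ι R) c x)
      map_lie' {x y} := Subtype.ext ((ι R).map_lie x y) }
  have val_comp_lift : A.val.comp (lift R j) = AlgHom.id R _ := by
    refine UniversalEnvelopingAlgebra.hom_ext R (LieHom.ext fun x => ?_)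
    exact congrArg A.val (UniversalEnvelopingAlgebra.lift_ι_apply R j x)
  refine eq_top_iff.2 fun u _ => ?_
  rw [← AlgHom.id_apply (R := R) u, ← val_comp_lift]
  exact (lift R j u).2

variable {M N : Type*}
  [AddCommGroup M] [Module R M] [Module (𝒰 R L) M] [IsScalarTower R (𝒰 R L) M]
  [AddCommGroup N] [Module R N] [Module (𝒰 R L) N] [IsScalarTower R (𝒰 R L) N]

/-- A linear map commuting with the action of a Lie algebra commutes with that of its enveloping
algebra. -/
def uLinear (φ : M →ₗ[R] N)
    (hφ : ∀ (x : L) (m : M), φ ((ι R x : 𝒰 R L) • m) = (ι R x : 𝒰 R L) • φ m) : M →ₗ[𝒰 R L] N where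
  __ := φ
  map_smul' u := by
    change ∀ m, φ (u • m) = u • φ m
    have hu : u ∈ Algebra.adjoin R (Set.range (ι R : L → 𝒰 R L)) := by
      rw [adjoin_range_ι]
      exact Algebra.mem_top
    induction hu using Algebra.adjoin_induction with
    | mem u hu =>
      obtain ⟨x, rfl⟩ := hu
      exact hφ x
    | algebraMap r => exact fun m => by simp only [algebraMap_smul, map_smul]
    | add u v _ _ hu hv => exact fun m => by simp only [add_smul, map_add, hu, hv]
    | mul u v _ _ hu hv => exact fun m => by simp only [mul_smul, hu, hv]

end Enveloping

section Model

open MvPolynomial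
open UniversalEnvelopingAlgebra (ι)
open scoped IsMulCommutative

variable {n : ℕ}

local notation "𝒰" => UniversalEnvelopingAlgebra

theorem ι_eq_add (x : Galilei n) :
    (ι ℂ x : 𝒰 ℂ (Galilei n)) =
      ι ℂ (LieAlgebra.SemiDirectSum.inl (Irrep.derivation n) x.left) +
        ι ℂ (sl2Incl n x.right) := by
  rw [← map_add]
  congr 1
  change x = ⟨x.left + 0, 0 + x.right⟩
  rw [add_zero, zero_add]

theorem radVec_eq (j : Fin (n + 1)) : radVec n j =
    ι ℂ (LieAlgebra.SemiDirectSum.inl (Irrep.derivation n) (Irrep.vec n j)) := by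
  rw [Irrep.vec_eq_single]
  rfl

instance : IsMulCommutative (Algebra.adjoin ℂ (Set.range (radVec n))) :=
  Algebra.isMulCommutative_adjoin ℂ (by
    rintro _ ⟨i, rfl⟩ _ ⟨j, rfl⟩
    rw [radVec_eq, radVec_eq, ← sub_eq_zero, ← ι_lie, ← LieHom.map_lie]
    exact (congrArg _ (map_zero _)).trans (map_zero (ι ℂ)))

/-- The homomorphism from the symmetric algebra of the abelian ideal `L(n)` to the enveloping
algebra of `L^n`. -/
def polyToU : SymAlg n →ₐ[ℂ] 𝒰 ℂ (Galilei n) :=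
  (Algebra.adjoin ℂ (Set.range (radVec n))).val.comp
    (aeval fun j => ⟨radVec n j, Algebra.subset_adjoin ⟨j, rfl⟩⟩)

theorem polyToU_X (j : Fin (n + 1)) : polyToU (X j) = radVec n j := by
  rw [polyToU, AlgHom.comp_apply, aeval_X]
  rfl

theorem polyToU_linForm (w : Irrep n) : polyToU (linForm w) =
    ι ℂ (LieAlgebra.SemiDirectSum.inl (Irrep.derivation n) w) := by
  rw [w.eq_sum_vec]
  simp only [map_sum, map_smul, linForm_vec, polyToU_X, radVec_eq]

theorem ι_mul_polyToU (x : Sl2) (p : SymAlg n) :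
    ι ℂ (sl2Incl n x) * polyToU p =
      polyToU p * ι ℂ (sl2Incl n x) + polyToU (symDerivation x p) := by
  induction p using MvPolynomial.induction_on with
  | C a =>
    rw [← algebraMap_eq, AlgHom.commutes, Derivation.map_algebraMap, map_zero, add_zero,
      Algebra.commutes]
  | add p q hp hq =>
    simp only [map_add, mul_add, add_mul, hp, hq]
    abel
  | mul_X p j hp =>
    have lie_vec : ⁅sl2Incl n x, LieAlgebra.SemiDirectSum.inl (Irrep.derivation n) (Irrep.vec n j)⁆
        = LieAlgebra.SemiDirectSum.inl (Irrep.derivation n) ⁅x, Irrep.vec n j⁆ := by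
      change (⟨0 + ⁅x, Irrep.vec n j⁆ - ⁅(0 : Sl2), (0 : Irrep n)⁆, ⁅x, (0 : Sl2)⁆⟩ : Galilei n) = _
      rw [zero_add, zero_lie, sub_zero, lie_zero]
      rfl
    have ι_mul_radVec : ι ℂ (sl2Incl n x) * radVec n j =
        radVec n j * ι ℂ (sl2Incl n x) + polyToU (symDerivation x (X j)) := by
      rw [symDerivation_X, polyToU_linForm, ← lie_vec, ι_lie, radVec_eq, add_sub_cancel]
    rw [Derivation.leibniz, smul_eq_mul, smul_eq_mul, mul_comm (X j : SymAlg n), map_add, map_mul,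
      map_mul, map_mul, polyToU_X, ← mul_assoc, hp, add_mul, mul_assoc, ι_mul_radVec]
    noncomm_ring

/-- The action of the enveloping algebra of `L^n` on the symmetric algebra of `L(n)`. -/
instance : Module (𝒰 ℂ (Galilei n)) (SymAlg n) :=
  Module.compHom (SymAlg n)
    (UniversalEnvelopingAlgebra.lift ℂ (toEnd ℂ (Galilei n) (SymAlg n))).toRingHom

instance : IsScalarTower ℂ (𝒰 ℂ (Galilei n)) (SymAlg n) where
  smul_assoc c u p := LinearMap.congr_fun
    (map_smul (UniversalEnvelopingAlgebra.lift ℂ (toEnd ℂ (Galilei n) (SymAlg n))) c u) p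

theorem ι_smul (x : Galilei n) (p : SymAlg n) : (ι ℂ x : 𝒰 ℂ (Galilei n)) • p = ⁅x, p⁆ :=
  LinearMap.congr_fun
    (UniversalEnvelopingAlgebra.lift_ι_apply ℂ (toEnd ℂ (Galilei n) (SymAlg n)) x) p

theorem polyToU_smul (p q : SymAlg n) : polyToU p • q = p * q := by
  induction p using MvPolynomial.induction_on generalizing q with
  | C a => rw [← algebraMap_eq, AlgHom.commutes, algebraMap_smul, Algebra.smul_def]
  | add p p' hp hp' => rw [map_add, add_smul, hp, hp', add_mul]
  | mul_X p j hp =>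
    rw [map_mul, mul_smul, hp, polyToU_X, radVec_eq, ι_smul, inl_lie_eq, linForm_vec, mul_assoc]

variable (n) in
/-- The generator of `U(L^n) ⊗_{U(sl₂)} L(0)`. -/
def inducedGen : Induced (sl2Incl n) (Irrep 0) :=
  Submodule.Quotient.mk ((1 : 𝒰 ℂ (Galilei n)) ⊗ₜ[ℂ] Irrep.vec 0 0)

theorem lie_irrep_zero (x : Sl2) (m : Irrep 0) : ⁅x, m⁆ = 0 :=
  Irrep.ext_coord fun j hj => by
    obtain rfl := Nat.le_zero.1 hj
    rw [Irrep.coord_lie _ _ Nat.one_pos, Irrep.coord_zero, Irrep.coord_of_le _ le_rfl]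
    simp

theorem ι_smul_inducedGen (x : Sl2) :
    (ι ℂ (sl2Incl n x) : 𝒰 ℂ (Galilei n)) • inducedGen n = 0 := by
  rw [inducedGen, ← Submodule.Quotient.mk_smul, Submodule.Quotient.mk_eq_zero]
  refine Submodule.subset_span ⟨1, x, Irrep.vec 0 0, ?_⟩
  rw [lie_irrep_zero, TensorProduct.tmul_zero, sub_zero, one_mul, TensorProduct.smul_tmul',
    smul_eq_mul, mul_one]

/-- The `U(L^n)`-linear map `p ↦ p ⊗ 1`. -/
def symToInduced : SymAlg n →ₗ[𝒰 ℂ (Galilei n)] Induced (sl2Incl n) (Irrep 0) :=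
  uLinear ((LinearMap.toSpanSingleton _ _ (inducedGen n)).restrictScalars ℂ ∘ₗ
      (polyToU (n := n)).toLinearMap) fun x p => by
    change polyToU ((ι ℂ x : 𝒰 ℂ (Galilei n)) • p) • inducedGen n = ι ℂ x • polyToU p • inducedGen n
    rw [ι_smul, galilei_lie_def, ← mul_smul, ι_eq_add x, add_mul, ι_mul_polyToU, map_add, map_mul,
      polyToU_linForm, add_smul, add_smul, add_smul, mul_smul (polyToU p), ι_smul_inducedGen,
      smul_zero, zero_add]

theorem symToInduced_apply (p : SymAlg n) : symToInduced p = polyToU p • inducedGen n := rfl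

/-- The `U(L^n)`-linear map `u ⊗ c ↦ c (u · 1)`. -/
def tensorToSym : 𝒰 ℂ (Galilei n) ⊗[ℂ] Irrep 0 →ₗ[𝒰 ℂ (Galilei n)] SymAlg n :=
  TensorProduct.AlgebraTensorModule.lift
    (LinearMap.toSpanSingleton _ _ (LinearMap.toSpanSingleton ℂ (SymAlg n) 1 ∘ₗ
      (LinearMap.proj 0 : (Fin 1 → ℂ) →ₗ[ℂ] ℂ)))

theorem tensorToSym_tmul (u : 𝒰 ℂ (Galilei n)) (m : Irrep 0) :
    tensorToSym (u ⊗ₜ[ℂ] m) = u • m 0 • (1 : SymAlg n) := rfl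

theorem inductionRelations_le_ker_tensorToSym :
    inductionRelations (sl2Incl n) (Irrep 0) ≤ LinearMap.ker (tensorToSym (n := n)) := by
  refine Submodule.span_le.2 ?_
  rintro _ ⟨u, x, m, rfl⟩
  have ι_smul_const (c : ℂ) : (ι ℂ (sl2Incl n x) : 𝒰 ℂ (Galilei n)) • c • (1 : SymAlg n) = 0 := by
    rw [ι_smul, lie_smul]
    change c • ⁅x, (1 : SymAlg n)⁆ = 0
    rw [sl2_lie_eq, Derivation.map_one_eq_zero, smul_zero]
  rw [SetLike.mem_coe, LinearMap.mem_ker, lie_irrep_zero, TensorProduct.tmul_zero, sub_zero,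
    tensorToSym_tmul, mul_smul, ι_smul_const, smul_zero]

/-- The module `U(L^n) ⊗_{U(sl₂)} L(0)` is the symmetric algebra of `L(n)`. -/
def symEquivInduced : SymAlg n ≃ₗ[𝒰 ℂ (Galilei n)] Induced (sl2Incl n) (Irrep 0) :=
  have tensorToSym_gen : tensorToSym (n := n) (1 ⊗ₜ[ℂ] Irrep.vec 0 0) = 1 := by
    rw [tensorToSym_tmul, one_smul]
    exact one_smul ℂ 1
  .ofLinearMap symToInduced (Submodule.liftQ _ tensorToSym inductionRelations_le_ker_tensorToSym)
    (Submodule.linearMap_qext _ <| TensorProduct.AlgebraTensorModule.ext fun u m => by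
      have hm : m = m 0 • Irrep.vec 0 0 :=
        Irrep.eq_smul_vec_zero_of_lie_e_eq_zero (lie_irrep_zero _ m)
      change symToInduced (tensorToSym (u ⊗ₜ m)) = Submodule.Quotient.mk (u ⊗ₜ m)
      rw [tensorToSym_tmul, map_smul, ← algebraMap_smul (𝒰 ℂ (Galilei n)) (m 0), map_smul,
        symToInduced_apply, map_one, one_smul, inducedGen, algebraMap_smul,
        ← Submodule.Quotient.mk_smul, ← Submodule.Quotient.mk_smul, ← TensorProduct.tmul_smul, ← hm,
        TensorProduct.smul_tmul', smul_eq_mul, mul_one])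
    (LinearMap.ext fun p => by
      change tensorToSym (polyToU p • (1 ⊗ₜ[ℂ] Irrep.vec 0 0)) = p
      rw [map_smul, tensorToSym_gen, polyToU_smul, mul_one])

theorem symEquivInduced_mem_mulSubmodule_iff {z p : SymAlg n} (hz : ∀ x, symDerivation x z = 0) :
    symEquivInduced p ∈ mulSubmodule (polyToU z) (Induced (sl2Incl n) (Irrep 0)) ↔ z ∣ p := by
  let mulZ : SymAlg n →ₗ[𝒰 ℂ (Galilei n)] SymAlg n :=
    uLinear (LinearMap.mulLeft ℂ z) fun x q => by
      rw [ι_smul, ι_smul, LinearMap.mulLeft_apply, LinearMap.mulLeft_apply, galilei_lie_def,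
        galilei_lie_def, Derivation.leibniz, hz, smul_zero, add_zero, smul_eq_mul, mul_add,
        mul_left_comm]
  have mulSubmodule_eq : mulSubmodule (polyToU z) (Induced (sl2Incl n) (Irrep 0)) =
      (LinearMap.range mulZ).map symEquivInduced.toLinearMap := by
    rw [mulSubmodule, ← LinearMap.range_comp]
    refine (congrArg _ ?_).trans (Submodule.span_eq _)
    rw [LinearMap.coe_range, ← symEquivInduced.surjective.range_comp]
    congr 1
    funext q
    simp only [Function.comp_apply, ← map_smul, polyToU_smul]
    rfl
  rw [mulSubmodule_eq, Submodule.mem_map_equiv, symEquivInduced.symm_apply_apply]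
  exact ⟨fun ⟨q, hq⟩ => ⟨q, hq.symm⟩, fun ⟨q, hq⟩ => ⟨q, hq.symm⟩⟩

end Model

section Discriminant

open MvPolynomial

theorem symDerivation_e_X_zero {n : ℕ} : symDerivation Sl2.e (X 0 : SymAlg n) = 0 := by
  rw [symDerivation_X]
  exact (congrArg linForm Irrep.lie_e_vec_zero).trans (map_zero _)

theorem symDerivation_e_X_succ {n : ℕ} (j : Fin n) :
    symDerivation Sl2.e (X j.succ : SymAlg n) = ((n : ℂ) - j) • X j.castSucc := by
  rw [symDerivation_X, Fin.val_succ, Irrep.lie_e_vec_succ, map_smul]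
  exact congrArg _ (linForm_vec j.castSucc)

theorem symDerivation_f_X_last {n : ℕ} : symDerivation Sl2.f (X (Fin.last n) : SymAlg n) = 0 := by
  have vec_succ : Irrep.vec n (n + 1) = 0 :=
    Irrep.ext_coord fun j hj => by
      rw [Irrep.coord_vec hj, if_neg (by omega), Irrep.coord_zero]
  rw [symDerivation_X, Fin.val_last, Irrep.lie_f_vec, vec_succ, smul_zero, map_zero]

theorem symDerivation_f_X_castSucc {n : ℕ} (j : Fin n) :
    symDerivation Sl2.f (X j.castSucc : SymAlg n) = ((j : ℂ) + 1) • X j.succ := by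
  rw [symDerivation_X, Fin.val_castSucc, Irrep.lie_f_vec, map_smul]
  exact congrArg _ (linForm_vec j.succ)

theorem symDerivation_h_X {n : ℕ} (j : Fin (n + 1)) :
    symDerivation Sl2.h (X j : SymAlg n) = ((n : ℂ) - 2 * j) • X j := by
  rw [symDerivation_X, Irrep.lie_h_vec, map_smul, linForm_vec]

theorem symDerivation_e_cubic :
    symDerivation Sl2.e (X 0 : SymAlg 3) = 0 ∧ symDerivation Sl2.e (X 1 : SymAlg 3) = 3 * X 0 ∧
    symDerivation Sl2.e (X 2 : SymAlg 3) = 2 * X 1 ∧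
    symDerivation Sl2.e (X 3 : SymAlg 3) = X 2 := by
  refine ⟨symDerivation_e_X_zero, (symDerivation_e_X_succ 0).trans ?_,
    (symDerivation_e_X_succ 1).trans ?_, (symDerivation_e_X_succ 2).trans ?_⟩ <;>
  norm_num [smul_eq_C_mul, map_ofNat]
  rfl

theorem symDerivation_f_cubic :
    symDerivation Sl2.f (X 0 : SymAlg 3) = X 1 ∧ symDerivation Sl2.f (X 1 : SymAlg 3) = 2 * X 2 ∧
    symDerivation Sl2.f (X 2 : SymAlg 3) = 3 * X 3 ∧
    symDerivation Sl2.f (X 3 : SymAlg 3) = 0 := by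
  refine ⟨(symDerivation_f_X_castSucc 0).trans ?_, (symDerivation_f_X_castSucc 1).trans ?_,
    (symDerivation_f_X_castSucc 2).trans ?_, symDerivation_f_X_last⟩ <;>
  norm_num [smul_eq_C_mul, map_ofNat]
  rfl

/-- The discriminant of the binary cubic with coefficients `X 0, X 1, X 2, X 3`. -/
def disc : SymAlg 3 :=
  X 2 ^ 2 * X 1 ^ 2 - 27 * X 3 ^ 2 * X 0 ^ 2 - 4 * X 2 ^ 3 * X 0 - 4 * X 3 * X 1 ^ 3 +
    18 * X 3 * X 2 * X 1 * X 0

theorem derivation_ofNat {R A M : Type*} [CommSemiring R] [CommSemiring A] [Algebra R A]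
    [AddCommMonoid M] [IsCancelAdd M] [Module A M] [Module R M] (D : Derivation R A M) (k : ℕ)
    [k.AtLeastTwo] : D (no_index (OfNat.ofNat k)) = 0 :=
  D.map_natCast k

theorem symDerivation_disc (x : Sl2) : symDerivation x disc = 0 := by
  have he : ⁅Sl2.e, disc⁆ = 0 := by
    obtain ⟨h0, h1, h2, h3⟩ := symDerivation_e_cubic
    simp only [sl2_lie_eq, disc, map_add, map_sub, Derivation.leibniz, Derivation.leibniz_pow,
      derivation_ofNat, h0, h1, h2, h3, smul_eq_mul, nsmul_eq_mul]
    push_cast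
    ring
  have hf : ⁅Sl2.f, disc⁆ = 0 := by
    obtain ⟨h0, h1, h2, h3⟩ := symDerivation_f_cubic
    simp only [sl2_lie_eq, disc, map_add, map_sub, Derivation.leibniz, Derivation.leibniz_pow,
      derivation_ofNat, h0, h1, h2, h3, smul_eq_mul, nsmul_eq_mul]
    push_cast
    ring
  rw [← sl2_lie_eq, x.eq_smul_add_smul_add_smul, ← Sl2.isSl2Triple.lie_e_f]
  simp only [add_lie, smul_lie, lie_lie, he, hf, lie_zero, sub_zero, smul_zero, add_zero]

theorem polyToU_disc_sub_C (χ : ℂ) :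
    polyToU (disc - C χ) = cubicDiscriminant - algebraMap ℂ _ χ := by
  rw [map_sub, ← algebraMap_eq, AlgHom.commutes]
  simp only [disc, cubicDiscriminant, map_add, map_sub, map_mul, map_pow, map_ofNat, polyToU_X]

/-- The quotient map from the symmetric algebra of `L(3)` to `Q(0, χ)`. -/
def symToQ0χ (χ : ℂ) : SymAlg 3 →ₗ⁅ℂ,Galilei 3⁆ Q0χ χ where
  __ := ((mulSubmodule (cubicDiscriminant - algebraMap ℂ _ χ) Q0).mkQ ∘ₗ
    symEquivInduced.toLinearMap).restrictScalars ℂ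
  map_lie' {x p} := by
    rw [← ι_smul]
    exact map_smul ((mulSubmodule (cubicDiscriminant - algebraMap ℂ _ χ) Q0).mkQ ∘ₗ
      symEquivInduced.toLinearMap) _ p

theorem symToQ0χ_surjective (χ : ℂ) : Function.Surjective (symToQ0χ χ) :=
  (Submodule.mkQ_surjective (mulSubmodule (cubicDiscriminant - algebraMap ℂ _ χ) Q0)).comp
    symEquivInduced.surjective

theorem symToQ0χ_eq_zero_iff {χ : ℂ} {p : SymAlg 3} : symToQ0χ χ p = 0 ↔ disc - C χ ∣ p := by
  have deriv_eq_zero (x : Sl2) : symDerivation x (disc - C χ) = 0 := by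
    rw [map_sub, symDerivation_disc, ← algebraMap_eq, Derivation.map_algebraMap, sub_zero]
  rw [← symEquivInduced_mem_mulSubmodule_iff deriv_eq_zero, polyToU_disc_sub_C]
  exact Submodule.Quotient.mk_eq_zero _

end Discriminant

/-- The restriction of a homomorphism of `L`-modules to `g`. -/
def resHom {g L M N : Type} [LieRing g] [LieAlgebra ℂ g] [LieRing L] [LieAlgebra ℂ L]
    [AddCommGroup M] [Module ℂ M] [LieRingModule L M] [LieModule ℂ L M]
    [AddCommGroup N] [Module ℂ N] [LieRingModule L N] [LieModule ℂ L N]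
    (i : g →ₗ⁅ℂ⁆ L) (φ : M →ₗ⁅ℂ,L⁆ N) : Res i M →ₗ⁅ℂ,g⁆ Res i N where
  __ := (φ : M →ₗ[ℂ] N)
  map_lie' {x m} := φ.map_lie (i x) m

section Integrability

open MvPolynomial

variable {A : Type*} [CommRing A] [Algebra ℂ A]

/-- The subalgebra of the elements killed by some power of a derivation. -/
def locallyNilpotentSubalgebra (D : Derivation ℂ A A) : Subalgebra ℂ A where
  carrier := {a | ∃ k : ℕ, D^[k] a = 0}
  algebraMap_mem' c := ⟨1, D.map_algebraMap c⟩
  add_mem' {a b} := by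
    rintro ⟨k, hk⟩ ⟨l, hl⟩
    refine ⟨k + l, ?_⟩
    rw [iterate_map_add, add_comm k l, Function.iterate_add_apply, hk, add_comm l k,
      Function.iterate_add_apply, hl, iterate_map_zero, iterate_map_zero, add_zero]
  mul_mem' {a b} := by
    rintro ⟨k, hk⟩ ⟨l, hl⟩
    refine ⟨k + l, ?_⟩
    induction hN : k + l generalizing a b k l with
    | zero =>
      obtain ⟨rfl, rfl⟩ := Nat.add_eq_zero_iff.1 hN
      rw [show a = 0 from hk, zero_mul, iterate_map_zero]
    | succ N ih =>
      rcases k with _ | k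
      · rw [show a = 0 from hk, zero_mul, iterate_map_zero]
      rcases l with _ | l
      · rw [show b = 0 from hl, mul_zero, iterate_map_zero]
      rw [Function.iterate_succ_apply, D.leibniz, iterate_map_add, smul_eq_mul, smul_eq_mul,
        mul_comm b, ih (k + 1) hk l hl (by omega), ih k hk (l + 1) hl (by omega), add_zero]

variable {n : ℕ}

theorem iterate_symDerivation_linForm (x : Sl2) (k : ℕ) (w : Irrep n) :
    (symDerivation x)^[k] (linForm w) = linForm ((toEnd ℂ Sl2 (Irrep n) x ^ k) w) := by
  induction k with
  | zero => rfl
  | succ k ih =>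
    rw [Function.iterate_succ_apply', ih, symDerivation_linForm, pow_succ']
    rfl

theorem toEnd_symAlg_pow (x : Sl2) (k : ℕ) (p : SymAlg n) :
    (toEnd ℂ Sl2 (SymAlg n) x ^ k) p = (symDerivation x)^[k] p := by
  rw [Module.End.pow_apply, show ⇑(toEnd ℂ Sl2 (SymAlg n) x) = symDerivation x from
    funext (sl2_lie_eq x)]

theorem exists_toEnd_symAlg_pow_eq_zero {x : Sl2} {k : ℕ} (hx : toEnd ℂ Sl2 (Irrep n) x ^ k = 0)
    (p : SymAlg n) : ∃ l : ℕ, (toEnd ℂ Sl2 (SymAlg n) x ^ l) p = 0 := by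
  have adjoin_le : Algebra.adjoin ℂ (Set.range (X : Fin (n + 1) → SymAlg n)) ≤
      locallyNilpotentSubalgebra (symDerivation (n := n) x) := by
    refine Algebra.adjoin_le ?_
    rintro _ ⟨j, rfl⟩
    refine ⟨k, ?_⟩
    rw [← linForm_vec, iterate_symDerivation_linForm, hx, LinearMap.zero_apply, map_zero]
  simp only [toEnd_symAlg_pow]
  exact adjoin_le ((adjoin_range_X (R := ℂ)).symm ▸ Algebra.mem_top)

theorem mem_weightSpace_symAlg {μ : ℂ} {p : SymAlg n} :
    p ∈ weightSpace (SymAlg n) Sl2.h μ ↔ symDerivation Sl2.h p = μ • p := by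
  rw [mem_weightSpace, sl2_lie_eq]

theorem X_mem_weightSpace (j : Fin (n + 1)) :
    X j ∈ weightSpace (SymAlg n) Sl2.h ((n : ℂ) - 2 * j) :=
  mem_weightSpace_symAlg.2 (symDerivation_h_X j)

theorem C_mem_weightSpace (a : ℂ) : C a ∈ weightSpace (SymAlg n) Sl2.h (0 : ℂ) := by
  rw [mem_weightSpace_symAlg, ← algebraMap_eq, Derivation.map_algebraMap, zero_smul]

theorem mul_mem_weightSpace {μ ν : ℂ} {p q : SymAlg n} (hp : p ∈ weightSpace (SymAlg n) Sl2.h μ)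
    (hq : q ∈ weightSpace (SymAlg n) Sl2.h ν) :
    p * q ∈ weightSpace (SymAlg n) Sl2.h (μ + ν) := by
  rw [mem_weightSpace_symAlg] at *
  rw [Derivation.leibniz, hp, hq, smul_eq_mul, smul_eq_mul, mul_smul_comm, mul_smul_comm,
    mul_comm q p, add_smul, add_comm]

theorem pow_mem_weightSpace {μ : ℂ} {p : SymAlg n} (hp : p ∈ weightSpace (SymAlg n) Sl2.h μ)
    (k : ℕ) : p ^ k ∈ weightSpace (SymAlg n) Sl2.h (k * μ) := by
  induction k with
  | zero =>
    rw [pow_zero, Nat.cast_zero, zero_mul]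
    exact C_mem_weightSpace 1
  | succ k ih =>
    rw [pow_succ, Nat.cast_succ, add_one_mul]
    exact mul_mem_weightSpace ih hp

variable (n) in
theorem isIntegrable_symAlg : IsIntegrable ℂ (SymAlg n) Sl2.h Sl2.e Sl2.f where
  iSup_weightSpace := by
    refine eq_top_iff.2 fun p _ => ?_
    induction p using MvPolynomial.induction_on with
    | C a => exact Submodule.mem_iSup_of_mem 0 (C_mem_weightSpace a)
    | add p q hp hq => exact add_mem (hp trivial) (hq trivial)
    | mul_X p j hp =>
      have map_mulRight_le : (⨆ μ : ℂ, weightSpace (SymAlg n) Sl2.h μ).map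
          (LinearMap.mulRight ℂ (X j)) ≤ ⨆ μ : ℂ, weightSpace (SymAlg n) Sl2.h μ := by
        rw [Submodule.map_iSup]
        refine iSup_le fun μ => le_trans ?_ (le_iSup _ (μ + ((n : ℂ) - 2 * j)))
        rintro _ ⟨q, hq, rfl⟩
        exact mul_mem_weightSpace hq (X_mem_weightSpace j)
      exact map_mulRight_le ⟨p, hp trivial, rfl⟩
  e_nilpotent := exists_toEnd_symAlg_pow_eq_zero Irrep.e_pow_succ_eq_zero
  f_nilpotent := exists_toEnd_symAlg_pow_eq_zero Irrep.f_pow_succ_eq_zero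

end Integrability

/-! ### Seminvariants of the binary cubic -/

section Covariants

open MvPolynomial

/-- The leading coefficient of the Hessian of the binary cubic with coefficients `X j`. -/
def hess : SymAlg 3 := X 1 ^ 2 - 3 * X 0 * X 2

/-- The leading coefficient of the cubic covariant of the binary cubic with coefficients `X j`. -/
def cov : SymAlg 3 := 27 * X 0 ^ 2 * X 3 - 9 * X 0 * X 1 * X 2 + 2 * X 1 ^ 3

theorem cov_sq : cov ^ 2 = 4 * hess ^ 3 - 27 * X 0 ^ 2 * disc := by
  rw [cov, hess, disc]
  ring

theorem symDerivation_h_cubic :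
    symDerivation Sl2.h (X 0 : SymAlg 3) = 3 * X 0 ∧ symDerivation Sl2.h (X 1 : SymAlg 3) = X 1 ∧
    symDerivation Sl2.h (X 2 : SymAlg 3) = -X 2 ∧
    symDerivation Sl2.h (X 3 : SymAlg 3) = -3 * X 3 := by
  refine ⟨(symDerivation_h_X 0).trans ?_, (symDerivation_h_X 1).trans ?_,
    (symDerivation_h_X 2).trans ?_, (symDerivation_h_X 3).trans ?_⟩ <;>
  norm_num [smul_eq_C_mul, map_ofNat]

theorem mem_highestWeightSpace_symAlg {n : ℕ} {μ : ℂ} {p : SymAlg n} :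
    p ∈ highestWeightSpace (SymAlg n) Sl2.h Sl2.e μ ↔
      symDerivation Sl2.h p = μ • p ∧ symDerivation Sl2.e p = 0 := by
  rw [mem_highestWeightSpace, sl2_lie_eq, sl2_lie_eq]

theorem X_zero_mem_highestWeightSpace (n : ℕ) :
    X 0 ∈ highestWeightSpace (SymAlg n) Sl2.h Sl2.e (n : ℂ) :=
  mem_highestWeightSpace_symAlg.2 ⟨by simpa using symDerivation_h_X (n := n) 0,
    symDerivation_e_X_zero⟩

theorem hess_mem_highestWeightSpace :
    hess ∈ highestWeightSpace (SymAlg 3) Sl2.h Sl2.e (2 : ℂ) := by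
  obtain ⟨h0, h1, h2, -⟩ := symDerivation_h_cubic
  obtain ⟨e0, e1, e2, -⟩ := symDerivation_e_cubic
  refine mem_highestWeightSpace_symAlg.2 ⟨?_, ?_⟩ <;>
  simp only [hess, map_sub, Derivation.leibniz, Derivation.leibniz_pow, derivation_ofNat, h0, h1,
    h2, e0, e1, e2, smul_eq_mul, nsmul_eq_mul, smul_eq_C_mul, map_ofNat] <;>
  push_cast <;>
  ring

theorem cov_mem_highestWeightSpace : cov ∈ highestWeightSpace (SymAlg 3) Sl2.h Sl2.e (3 : ℂ) := by
  obtain ⟨h0, h1, h2, h3⟩ := symDerivation_h_cubic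
  obtain ⟨e0, e1, e2, e3⟩ := symDerivation_e_cubic
  refine mem_highestWeightSpace_symAlg.2 ⟨?_, ?_⟩ <;>
  simp only [cov, map_add, map_sub, Derivation.leibniz, Derivation.leibniz_pow, derivation_ofNat,
    h0, h1, h2, h3, e0, e1, e2, e3, smul_eq_mul, nsmul_eq_mul, smul_eq_C_mul, map_ofNat] <;>
  push_cast <;>
  ring

/-- The one-parameter flow on `ℂ⁴` whose infinitesimal action on polynomial functions is that
of `e`. -/
def flow (v : Fin 4 → ℂ) (t : ℂ) : Fin 4 → ℂ :=
  ![v 0, v 1 + 3 * v 0 * t, v 2 + 2 * v 1 * t + 3 * v 0 * t ^ 2,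
    v 3 + v 2 * t + v 1 * t ^ 2 + v 0 * t ^ 3]

theorem hasDerivAt_flow (v : Fin 4 → ℂ) (t : ℂ) (j : Fin 4) :
    HasDerivAt (fun s => flow v s j) (eval (flow v t) (symDerivation Sl2.e (X j))) t := by
  have hasDerivAt_cubic (a b c d : ℂ) : HasDerivAt (fun s => a + b * s + c * s ^ 2 + d * s ^ 3)
      (b + 2 * c * t + 3 * d * t ^ 2) t := by
    have h := ((((hasDerivAt_id t).const_mul b).const_add a).fun_add
      ((hasDerivAt_pow 2 t).const_mul c)).fun_add ((hasDerivAt_pow 3 t).const_mul d)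
    refine h.congr_deriv ?_
    norm_num
    ring
  obtain ⟨h0, h1, h2, h3⟩ := symDerivation_e_cubic
  have d0 : HasDerivAt (fun s => flow v s 0) (eval (flow v t) (symDerivation Sl2.e (X 0))) t := by
    simpa [h0, flow] using hasDerivAt_cubic (v 0) 0 0 0
  have d1 : HasDerivAt (fun s => flow v s 1) (eval (flow v t) (symDerivation Sl2.e (X 1))) t := by
    simpa [h1, flow] using hasDerivAt_cubic (v 1) (3 * v 0) 0 0
  have d2 : HasDerivAt (fun s => flow v s 2) (eval (flow v t) (symDerivation Sl2.e (X 2))) t := by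
    simpa [h2, flow, mul_add, mul_assoc, mul_left_comm] using
      hasDerivAt_cubic (v 2) (2 * v 1) (3 * v 0) 0
  have d3 : HasDerivAt (fun s => flow v s 3) (eval (flow v t) (symDerivation Sl2.e (X 3))) t := by
    simpa [h3, flow] using hasDerivAt_cubic (v 3) (v 2) (v 1) (v 0)
  fin_cases j
  exacts [d0, d1, d2, d3]

theorem hasDerivAt_eval_flow (v : Fin 4 → ℂ) (t : ℂ) (p : SymAlg 3) :
    HasDerivAt (fun s => eval (flow v s) p) (eval (flow v t) (symDerivation Sl2.e p)) t := by
  induction p using MvPolynomial.induction_on with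
  | C a =>
    simp only [← algebraMap_eq, Derivation.map_algebraMap, map_zero]
    simpa only [algebraMap_eq, eval_C] using hasDerivAt_const t a
  | add p q hp hq => simpa only [map_add] using hp.fun_add hq
  | mul_X p j hp =>
    simp only [map_mul, eval_X, Derivation.leibniz, map_add, smul_eq_mul]
    rw [add_comm, mul_comm (flow v t j)]
    exact hp.fun_mul (hasDerivAt_flow v t j)

theorem eval_flow {p : SymAlg 3} (hp : symDerivation Sl2.e p = 0) (v : Fin 4 → ℂ) (t : ℂ) :
    eval (flow v t) p = eval v p := by
  have hderiv (s : ℂ) : HasDerivAt (fun s => eval (flow v s) p) 0 s := by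
    simpa only [hp, map_zero] using hasDerivAt_eval_flow v s p
  have flow_zero : flow v 0 = v := by
    ext j
    fin_cases j <;> simp [flow]
  rw [is_const_of_deriv_eq_zero (fun s => (hderiv s).differentiableAt) (fun s => (hderiv s).deriv)
    t 0, flow_zero]

/-- The point with `v₃ = a`, `v₁ = 0`, Hessian `h` and cubic covariant `t`, for `a ≠ 0`. -/
def slicePoint (a h t : ℂ) : Fin 4 → ℂ := ![a, 0, -h / (3 * a), t / (27 * a ^ 2)]

theorem eval_slicePoint {a : ℂ} (ha : a ≠ 0) (h t : ℂ) :
    eval (slicePoint a h t) hess = h ∧ eval (slicePoint a h t) cov = t ∧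
      27 * a ^ 2 * eval (slicePoint a h t) disc = 4 * h ^ 3 - t ^ 2 := by
  refine ⟨?_, ?_, ?_⟩
  · simp only [slicePoint, hess, map_sub, map_mul, map_pow, map_ofNat, eval_X, Matrix.cons_val]
    field_simp
    ring
  · simp only [slicePoint, cov, map_add, map_sub, map_mul, map_pow, map_ofNat, eval_X,
      Matrix.cons_val]
    field_simp
    ring
  · simp only [slicePoint, disc, map_add, map_sub, map_mul, map_pow, map_ofNat, eval_X,
      Matrix.cons_val]
    field_simp
    ring

theorem flow_eq_slicePoint {v : Fin 4 → ℂ} (hv : v 0 ≠ 0) :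
    flow v (-v 1 / (3 * v 0)) = slicePoint (v 0) (eval v hess) (eval v cov) := by
  ext j
  fin_cases j
  · rfl
  all_goals
    simp only [flow, slicePoint, hess, cov, map_add, map_sub, map_mul, map_pow, map_ofNat, eval_X,
      Matrix.cons_val, Fin.mk_one, Fin.reduceFinMk]
    field_simp
    ring

/-- The algebra generated by the seminvariants of degree at most three of the binary cubic. -/
def seminvAlgebra : Subalgebra ℂ (SymAlg 3) := Algebra.adjoin ℂ {X 0, hess, cov}

theorem seminvAlgebra_gens_mem :
    X 0 ∈ seminvAlgebra ∧ hess ∈ seminvAlgebra ∧ cov ∈ seminvAlgebra :=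
  ⟨Algebra.subset_adjoin (by simp), Algebra.subset_adjoin (by simp),
    Algebra.subset_adjoin (by simp)⟩

theorem exists_mem_seminvAlgebra_eval_eq (p : SymAlg 3) :
    ∃ N : ℕ, ∃ g ∈ seminvAlgebra, ∀ v : Fin 4 → ℂ, v 0 ≠ 0 →
      eval v g = v 0 ^ N * eval (slicePoint (v 0) (eval v hess) (eval v cov)) p := by
  obtain ⟨hX, hH, hT⟩ := seminvAlgebra_gens_mem
  induction p using MvPolynomial.induction_on with
  | C a => exact ⟨0, C a, seminvAlgebra.algebraMap_mem a, fun v _ => by simp⟩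
  | add p q hp hq =>
    obtain ⟨N, g, hg, hgv⟩ := hp
    obtain ⟨N', g', hg', hgv'⟩ := hq
    refine ⟨N + N', X 0 ^ N' * g + X 0 ^ N * g',
      add_mem (mul_mem (pow_mem hX _) hg) (mul_mem (pow_mem hX _) hg'), fun v hv => ?_⟩
    simp only [map_add, map_mul, map_pow, eval_X, hgv v hv, hgv' v hv]
    ring
  | mul_X p j hp =>
    obtain ⟨N, g, hg, hgv⟩ := hp
    fin_cases j
    · refine ⟨N, X 0 * g, mul_mem hX hg, fun v hv => ?_⟩
      rw [map_mul, map_mul, hgv v hv, eval_X, eval_X]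
      exact (mul_left_comm _ _ _).trans (congrArg _ (mul_comm _ _))
    · exact ⟨N, 0, zero_mem _, fun v _ => by simp [slicePoint]⟩
    · refine ⟨N + 1, (-1 / 3 : ℂ) • (hess * g), Subalgebra.smul_mem _ (mul_mem hH hg) _,
        fun v hv => ?_⟩
      rw [smul_eval, map_mul, map_mul, hgv v hv, eval_X]
      simp only [slicePoint, Fin.reduceFinMk, Matrix.cons_val]
      field_simp
      ring
    · refine ⟨N + 2, (1 / 27 : ℂ) • (cov * g), Subalgebra.smul_mem _ (mul_mem hT hg) _,
        fun v hv => ?_⟩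
      rw [smul_eval, map_mul, map_mul, hgv v hv, eval_X]
      simp only [slicePoint, Fin.reduceFinMk, Matrix.cons_val]
      field_simp
      ring

theorem eq_of_eval_eq_of_ne_zero {σ K : Type*} [Field K] [Infinite K] {p q : MvPolynomial σ K}
    (i : σ) (h : ∀ v : σ → K, v i ≠ 0 → eval v p = eval v q) : p = q :=
  funext_set (fun _ => {0}ᶜ) (fun _ => (Set.finite_singleton 0).infinite_compl)
    fun v hv => h v (hv i trivial)

theorem exists_pow_mul_mem_seminvAlgebra {p : SymAlg 3} (hp : symDerivation Sl2.e p = 0) :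
    ∃ N : ℕ, X 0 ^ N * p ∈ seminvAlgebra := by
  obtain ⟨N, g, hg, hgv⟩ := exists_mem_seminvAlgebra_eval_eq p
  refine ⟨N, ?_⟩
  convert hg using 1
  refine eq_of_eval_eq_of_ne_zero 0 fun v hv => ?_
  rw [hgv v hv, map_mul, map_pow, eval_X, ← flow_eq_slicePoint hv, eval_flow hp]

end Covariants

section Forms

open MvPolynomial

/-- The substitution of `X 0` and the Hessian in a polynomial in two variables. -/
def seminvHom : MvPolynomial (Fin 2) ℂ →ₐ[ℂ] SymAlg 3 := aeval ![X 0, hess]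

/-- The map `(U, V) ↦ U + T V`, where `T` is the cubic covariant and `X 0` and the Hessian are
substituted in `U` and `V`. -/
def seminvForm : MvPolynomial (Fin 2) ℂ × MvPolynomial (Fin 2) ℂ →ₗ[ℂ] SymAlg 3 :=
  seminvHom.toLinearMap.coprod (LinearMap.mulLeft ℂ cov ∘ₗ seminvHom.toLinearMap)

theorem seminvForm_apply (U V : MvPolynomial (Fin 2) ℂ) :
    seminvForm (U, V) = seminvHom U + cov * seminvHom V := rfl

theorem seminvHom_X_zero : seminvHom (X 0) = X 0 := aeval_X _ _

theorem seminvHom_X_one : seminvHom (X 1) = hess := aeval_X _ _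

theorem eval_seminvHom (v : Fin 4 → ℂ) (U : MvPolynomial (Fin 2) ℂ) :
    eval v (seminvHom U) = eval ![v 0, eval v hess] U := by
  have comp_eq : (aeval v).comp seminvHom = aeval ![v 0, eval v hess] :=
    algHom_ext fun j => by
      fin_cases j
      · simp [seminvHom_X_zero]
      · simp [seminvHom_X_one, aeval_eq_eval]
  exact DFunLike.congr_fun comp_eq U

theorem eval_seminvForm (v : Fin 4 → ℂ) (U V : MvPolynomial (Fin 2) ℂ) :
    eval v (seminvForm (U, V)) =
      eval ![v 0, eval v hess] U + eval v cov * eval ![v 0, eval v hess] V := by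
  rw [seminvForm_apply, map_add, map_mul, eval_seminvHom, eval_seminvHom]

/-- The polynomials congruent modulo `disc - χ` to a value of `seminvForm`. -/
def seminvFormAlgebra (χ : ℂ) : Subalgebra ℂ (SymAlg 3) where
  carrier := {p | ∃ w, disc - C χ ∣ p - seminvForm w}
  algebraMap_mem' c := ⟨(C c, 0), by
    rw [seminvForm_apply, map_zero, mul_zero, add_zero, seminvHom, aeval_C, sub_self]
    exact dvd_zero _⟩
  add_mem' {p q} := by
    rintro ⟨w, hw⟩ ⟨w', hw'⟩
    refine ⟨w + w', ?_⟩
    rw [map_add, add_sub_add_comm]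
    exact dvd_add hw hw'
  mul_mem' {p q} := by
    rintro ⟨⟨U, V⟩, a, ha⟩ ⟨⟨U', V'⟩, b, hb⟩
    refine ⟨(U * U' + (4 * X 1 ^ 3 - 27 * C χ * X 0 ^ 2) * (V * V'), U * V' + V * U'),
      a * q + seminvForm (U, V) * b - 27 * X 0 ^ 2 * (seminvHom V * seminvHom V'), ?_⟩
    have seminvHom_C : seminvHom (C χ) = C χ := aeval_C _ _
    simp only [seminvForm_apply, map_add, map_sub, map_mul, map_pow, map_ofNat, seminvHom_C,
      seminvHom_X_zero, seminvHom_X_one] at ha hb ⊢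
    linear_combination q * ha + (seminvHom U + cov * seminvHom V) * hb +
      seminvHom V * seminvHom V' * cov_sq

variable {χ : ℂ}

theorem seminvAlgebra_le_seminvFormAlgebra : seminvAlgebra ≤ seminvFormAlgebra χ := by
  have seminvForm_mem (w) : seminvForm w ∈ seminvFormAlgebra χ :=
    ⟨w, by rw [sub_self]; exact dvd_zero _⟩
  refine Algebra.adjoin_le fun p hp => ?_
  rw [SetLike.mem_coe]
  obtain rfl | rfl | rfl := hp
  · simpa only [seminvForm_apply, seminvHom_X_zero, map_zero, mul_zero, add_zero] using
      seminvForm_mem (X 0, 0)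
  · simpa only [seminvForm_apply, seminvHom_X_one, map_zero, mul_zero, add_zero] using
      seminvForm_mem (X 1, 0)
  · simpa only [seminvForm_apply, map_zero, map_one, mul_one, zero_add] using seminvForm_mem (0, 1)

theorem X_dvd_sub_aeval_update {σ R : Type*} [CommRing R] [DecidableEq σ] (i : σ)
    (p : MvPolynomial σ R) : X i ∣ p - aeval (Function.update X i 0) p := by
  rw [← Ideal.mem_span_singleton, ← Ideal.Quotient.eq]
  have mk_comp : (Ideal.Quotient.mkₐ R (Ideal.span {X i})).comp (AlgHom.id R _) =
      (Ideal.Quotient.mkₐ R (Ideal.span {X i})).comp (aeval (Function.update X i 0)) := by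
    refine algHom_ext fun j => ?_
    rcases eq_or_ne j i with rfl | hj
    · simp
    · simp [hj]
  exact DFunLike.congr_fun mk_comp p

theorem X_dvd_of_eval_eq_zero {σ K : Type*} [Field K] [Infinite K] {i j : σ} (hij : j ≠ i)
    {p : MvPolynomial σ K} (hp : ∀ v : σ → K, v i = 0 → v j ≠ 0 → eval v p = 0) : X i ∣ p := by
  classical
  have aeval_update_eq_zero : aeval (Function.update X i 0) p = (0 : MvPolynomial σ K) := by
    refine eq_of_eval_eq_of_ne_zero j fun v hv => ?_
    have eval_aeval : eval v (aeval (Function.update X i 0) p) =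
        eval (Function.update v i 0) p := by
      rw [← aeval_eq_eval, ← aeval_eq_eval, comp_aeval_apply]
      congr 2
      ext k
      rcases eq_or_ne k i with rfl | hk <;> simp [*]
    rw [eval_aeval, map_zero]
    exact hp _ (Function.update_self ..) (by rwa [Function.update_of_ne hij])
  simpa only [aeval_update_eq_zero, sub_zero] using X_dvd_sub_aeval_update i p

theorem eval_divisor_X_zero {s : ℂ} (hs : s ≠ 0) (c : ℂ) :
    eval ![0, s, 0, -c / (4 * s ^ 3)] hess = s ^ 2 ∧
      eval ![0, s, 0, -c / (4 * s ^ 3)] cov = 2 * s ^ 3 ∧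
      eval ![0, s, 0, -c / (4 * s ^ 3)] disc = c := by
  refine ⟨by simp [hess], by simp [cov], ?_⟩
  simp only [disc, map_add, map_sub, map_mul, map_pow, map_ofNat, eval_X, Matrix.cons_val]
  field_simp
  ring

theorem X_zero_dvd_of_X_zero_mul_sub_seminvForm {p : SymAlg 3} {U V : MvPolynomial (Fin 2) ℂ}
    (h : disc - C χ ∣ X 0 * p - seminvForm (U, V)) : X 0 ∣ U ∧ X 0 ∣ V := by
  obtain ⟨q, hq⟩ := h
  have eval_add_eq_zero {s : ℂ} (hs : s ≠ 0) :
      eval ![0, s ^ 2] U + 2 * s ^ 3 * eval ![0, s ^ 2] V = 0 := by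
    obtain ⟨hH, hT, hΔ⟩ := eval_divisor_X_zero hs χ
    have h₀ := congrArg (eval ![0, s, 0, -χ / (4 * s ^ 3)]) hq
    rw [map_sub, map_mul, map_mul, map_sub, eval_seminvForm, hH, hT, hΔ, eval_X, eval_C] at h₀
    simp only [Matrix.cons_val, zero_mul, zero_sub, sub_self] at h₀
    linear_combination -h₀
  have eval_eq_zero (v : Fin 2 → ℂ) (hv₀ : v 0 = 0) (hv₁ : v 1 ≠ 0) :
      eval v U = 0 ∧ eval v V = 0 := by
    obtain ⟨s, hs⟩ := IsAlgClosed.exists_pow_nat_eq (v 1) (n := 2) two_pos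
    have hs₀ : s ≠ 0 := by
      rintro rfl
      exact hv₁ (by rw [← hs, zero_pow two_ne_zero])
    have hv : v = ![0, s ^ 2] := by
      ext j
      fin_cases j
      exacts [hv₀, hs.symm]
    have h_pos := eval_add_eq_zero hs₀
    have h_neg := eval_add_eq_zero (neg_ne_zero.2 hs₀)
    rw [neg_sq] at h_neg
    rw [hv]
    refine ⟨by linear_combination (h_pos + h_neg) / 2, ?_⟩
    have : 4 * s ^ 3 * eval ![0, s ^ 2] V = 0 := by linear_combination h_pos - h_neg
    exact (mul_eq_zero.1 this).resolve_left (by simp [hs₀])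
  exact ⟨X_dvd_of_eval_eq_zero one_ne_zero fun v h₀ h₁ => (eval_eq_zero v h₀ h₁).1,
    X_dvd_of_eval_eq_zero one_ne_zero fun v h₀ h₁ => (eval_eq_zero v h₀ h₁).2⟩

theorem not_X_zero_dvd_disc_sub_C : ¬ X 0 ∣ disc - C χ := by
  rintro ⟨q, hq⟩
  have h₀ := congrArg (eval ![0, 1, 0, -(χ + 1) / (4 * 1 ^ 3)]) hq
  rw [map_sub, (eval_divisor_X_zero one_ne_zero (χ + 1)).2.2, map_mul, eval_X, eval_C] at h₀
  simp at h₀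

theorem mem_seminvFormAlgebra_of_X_zero_mul_mem {p : SymAlg 3}
    (hp : X 0 * p ∈ seminvFormAlgebra χ) : p ∈ seminvFormAlgebra χ := by
  obtain ⟨⟨U, V⟩, hUV⟩ := hp
  obtain ⟨⟨U, rfl⟩, ⟨V, rfl⟩⟩ := X_zero_dvd_of_X_zero_mul_sub_seminvForm hUV
  obtain ⟨q, hq⟩ := hUV
  have seminvForm_X_zero_mul : seminvForm (X 0 * U, X 0 * V) = X 0 * seminvForm (U, V) := by
    simp only [seminvForm_apply, map_mul, seminvHom_X_zero]
    ring
  rw [seminvForm_X_zero_mul, ← mul_sub] at hq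
  obtain ⟨q, rfl⟩ : X 0 ∣ q := (X_prime.dvd_or_dvd ⟨_, hq.symm⟩).resolve_left
    not_X_zero_dvd_disc_sub_C
  exact ⟨(U, V), q, mul_left_cancel₀ (X_ne_zero 0) (hq.trans (mul_left_comm _ _ _))⟩

theorem mem_seminvFormAlgebra_of_symDerivation_e_eq_zero {p : SymAlg 3}
    (hp : symDerivation Sl2.e p = 0) : p ∈ seminvFormAlgebra χ := by
  obtain ⟨N, hN⟩ := exists_pow_mul_mem_seminvAlgebra hp
  replace hN := seminvAlgebra_le_seminvFormAlgebra (χ := χ) hN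
  induction N with
  | zero => rwa [pow_zero, one_mul] at hN
  | succ N ih =>
    rw [pow_succ', mul_assoc] at hN
    exact ih (mem_seminvFormAlgebra_of_X_zero_mul_mem hN)

theorem eq_zero_of_disc_sub_C_dvd_seminvForm {w : MvPolynomial (Fin 2) ℂ × MvPolynomial (Fin 2) ℂ}
    (hw : disc - C χ ∣ seminvForm w) : w = 0 := by
  obtain ⟨U, V⟩ := w
  obtain ⟨q, hq⟩ := hw
  have eval_add_eq_zero {v : Fin 2 → ℂ} (hv : v 0 ≠ 0) {t : ℂ}
      (ht : t ^ 2 = 4 * v 1 ^ 3 - 27 * χ * v 0 ^ 2) : eval v U + t * eval v V = 0 := by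
    obtain ⟨hH, hT, hΔ⟩ := eval_slicePoint hv (v 1) t
    have hΔ' : eval (slicePoint (v 0) (v 1) t) disc = χ :=
      mul_left_cancel₀ (by simpa using hv : 27 * v 0 ^ 2 ≠ 0) (by linear_combination hΔ - ht)
    have h₀ := congrArg (eval (slicePoint (v 0) (v 1) t)) hq
    rw [eval_seminvForm, map_mul, map_sub, hH, hT, hΔ', eval_C, sub_self, zero_mul] at h₀
    rwa [show v = ![v 0, v 1] from List.ofFn_inj.1 rfl]
  have eval_eq_zero {v : Fin 2 → ℂ} (hv : v 0 ≠ 0) :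
      eval v U = 0 ∧ (4 * v 1 ^ 3 - 27 * χ * v 0 ^ 2) * eval v V = 0 := by
    obtain ⟨t, ht⟩ :=
      IsAlgClosed.exists_pow_nat_eq (4 * v 1 ^ 3 - 27 * χ * v 0 ^ 2) (n := 2) two_pos
    have h_pos := eval_add_eq_zero hv ht
    have h_neg := eval_add_eq_zero hv (t := -t) (by rw [neg_sq, ht])
    refine ⟨by linear_combination (h_pos + h_neg) / 2, ?_⟩
    rw [← ht]
    linear_combination t * (h_pos - h_neg) / 2
  have hU : U = 0 := eq_of_eval_eq_of_ne_zero 0 fun v hv => by rw [(eval_eq_zero hv).1, map_zero]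
  have hV : (4 * X 1 ^ 3 - 27 * C χ * X 0 ^ 2) * V = 0 :=
    eq_of_eval_eq_of_ne_zero 0 fun v hv => by simpa using (eval_eq_zero hv).2
  have coeff_ne_zero : (4 * X 1 ^ 3 - 27 * C χ * X 0 ^ 2 : MvPolynomial (Fin 2) ℂ) ≠ 0 :=
    fun h₀ => by simpa using congrArg (eval ![0, 1]) h₀
  rw [hU, (mul_eq_zero.1 hV).resolve_left coeff_ne_zero, Prod.mk_zero_zero]

end Forms

theorem mem_span_image_of_mem_eigenspace {K V ι : Type*} [Field K] [AddCommGroup V] [Module K V]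
    {T : Module.End K V} {b : ι → V} {μ : ι → K} (hb : LinearIndependent K b)
    (hT : ∀ i, T (b i) = μ i • b i) {ν : K} {v : V} (hv : v ∈ Submodule.span K (Set.range b))
    (hvν : v ∈ T.eigenspace ν) : v ∈ Submodule.span K (b '' {i | μ i = ν}) := by
  obtain ⟨c, rfl⟩ := Finsupp.mem_span_range_iff_exists_finsupp.1 hv
  have sum_eq_zero : ∑ i ∈ c.support, ((μ i - ν) * c i) • b i = 0 := by
    rw [← sub_eq_zero.2 (Module.End.mem_eigenspace_iff.1 hvν), Finsupp.sum, map_sum,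
      Finset.smul_sum, ← Finset.sum_sub_distrib]
    refine Finset.sum_congr rfl fun i _ => ?_
    rw [map_smul, hT, smul_smul, smul_smul, ← sub_smul, sub_mul, mul_comm (c i)]
  refine sum_mem fun i hi => Submodule.smul_mem _ _ (Submodule.subset_span ⟨i, ?_, rfl⟩)
  have coeff_eq_zero := linearIndependent_iff'.1 hb _ _ sum_eq_zero i hi
  exact sub_eq_zero.1 ((mul_eq_zero.1 coeff_eq_zero).resolve_right (Finsupp.mem_support_iff.1 hi))

section Seminvariants

open MvPolynomial

/-- The index set of the standard monomials `X 0 ^ i * hess ^ j` (on the left) and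
`cov * X 0 ^ i * hess ^ j` (on the right), a pair of exponents being a finitely supported
function. -/
abbrev SeminvIndex : Type := (Fin 2 →₀ ℕ) ⊕ (Fin 2 →₀ ℕ)

/-- The standard monomials in the seminvariants `X 0`, `hess` and `cov`, at most linear in
`cov`. -/
def seminv (x : SeminvIndex) : SymAlg 3 :=
  seminvForm ((basisMonomials (Fin 2) ℂ).prod (basisMonomials (Fin 2) ℂ) x)

/-- The `h`-weight of `seminv x`. -/
def seminvWeight : SeminvIndex → ℕ
  | Sum.inl m => 3 * m 0 + 2 * m 1
  | Sum.inr m => 3 * m 0 + 2 * m 1 + 3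

theorem seminvHom_monomial (m : Fin 2 →₀ ℕ) :
    seminvHom (monomial m 1) = X 0 ^ m 0 * hess ^ m 1 := by
  rw [seminvHom, aeval_monomial, map_one, one_mul, Finsupp.prod_pow, Fin.prod_univ_two]
  rfl

theorem seminv_inl (m : Fin 2 →₀ ℕ) : seminv (Sum.inl m) = X 0 ^ m 0 * hess ^ m 1 := by
  simp [seminv, Module.Basis.prod_apply, seminvForm_apply, seminvHom_monomial]

theorem seminv_inr (m : Fin 2 →₀ ℕ) :
    seminv (Sum.inr m) = cov * (X 0 ^ m 0 * hess ^ m 1) := by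
  simp [seminv, Module.Basis.prod_apply, seminvForm_apply, seminvHom_monomial]

theorem mul_mem_highestWeightSpace {n : ℕ} {μ ν : ℂ} {p q : SymAlg n}
    (hp : p ∈ highestWeightSpace (SymAlg n) Sl2.h Sl2.e μ)
    (hq : q ∈ highestWeightSpace (SymAlg n) Sl2.h Sl2.e ν) :
    p * q ∈ highestWeightSpace (SymAlg n) Sl2.h Sl2.e (μ + ν) := by
  refine mem_highestWeightSpace_symAlg.2
    ⟨mem_weightSpace_symAlg.1 (mul_mem_weightSpace hp.1 hq.1), ?_⟩
  rw [Derivation.leibniz, (mem_highestWeightSpace_symAlg.1 hp).2,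
    (mem_highestWeightSpace_symAlg.1 hq).2, smul_zero, smul_zero, add_zero]

theorem pow_mem_highestWeightSpace {n : ℕ} {μ : ℂ} {p : SymAlg n}
    (hp : p ∈ highestWeightSpace (SymAlg n) Sl2.h Sl2.e μ) (k : ℕ) :
    p ^ k ∈ highestWeightSpace (SymAlg n) Sl2.h Sl2.e (k * μ) := by
  refine mem_highestWeightSpace_symAlg.2 ⟨mem_weightSpace_symAlg.1 (pow_mem_weightSpace hp.1 k), ?_⟩
  rw [Derivation.leibniz_pow, (mem_highestWeightSpace_symAlg.1 hp).2, smul_zero, smul_zero]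

theorem seminv_mem_highestWeightSpace (x : SeminvIndex) :
    seminv x ∈ highestWeightSpace (SymAlg 3) Sl2.h Sl2.e (seminvWeight x : ℂ) := by
  have monomial_mem (m : Fin 2 →₀ ℕ) := mul_mem_highestWeightSpace
    (pow_mem_highestWeightSpace (X_zero_mem_highestWeightSpace 3) (m 0))
    (pow_mem_highestWeightSpace hess_mem_highestWeightSpace (m 1))
  rcases x with m | m
  · rw [seminv_inl]
    convert monomial_mem m using 2
    push_cast [seminvWeight]
    ring
  · rw [seminv_inr]
    convert mul_mem_highestWeightSpace cov_mem_highestWeightSpace (monomial_mem m) using 2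
    push_cast [seminvWeight]
    ring

theorem bijOn_seminvIndex (k : ℕ) :
    Set.BijOn (Sum.elim (fun m => m 0) fun m => m 0) {x : SeminvIndex | seminvWeight x = k}
      (Set.Iio (k + 1 - 2 * ((k + 2) / 3))) := by
  have ext_fin_two {m m' : Fin 2 →₀ ℕ} (h₀ : m 0 = m' 0) (h₁ : m 1 = m' 1) : m = m' :=
    Finsupp.ext (Fin.forall_fin_two.2 ⟨h₀, h₁⟩)
  refine ⟨?_, ?_, fun i hi => ?_⟩
  · rintro (m | m) (hm : _ = k) <;>
    simp only [seminvWeight, Sum.elim_inl, Sum.elim_inr, Set.mem_Iio] at hm ⊢ <;>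
    omega
  · rintro (m | m) (hm : _ = k) (m' | m') (hm' : _ = k) h₀ <;>
    simp only [seminvWeight, Sum.elim_inl, Sum.elim_inr] at hm hm' h₀
    · rw [ext_fin_two h₀ (by omega)]
    · omega
    · omega
    · rw [ext_fin_two h₀ (by omega)]
  · rw [Set.mem_Iio] at hi
    rcases Nat.even_or_odd' (i + k) with ⟨c, hc | hc⟩
    · refine ⟨Sum.inl (Finsupp.equivFunOnFinite.symm ![i, (k - 3 * i) / 2]), ?_, rfl⟩
      change 3 * i + 2 * ((k - 3 * i) / 2) = k
      omega
    · refine ⟨Sum.inr (Finsupp.equivFunOnFinite.symm ![i, (k - 3 - 3 * i) / 2]), ?_, rfl⟩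
      change 3 * i + 2 * ((k - 3 - 3 * i) / 2) + 3 = k
      omega

variable (χ : ℂ)

/-- The projection of the symmetric algebra of `L(3)` onto `Q(0, χ)`, restricted to `sl₂`. -/
def projQ0χ : SymAlg 3 →ₗ⁅ℂ,Sl2⁆ Res (sl2Incl 3) (Q0χ χ) := resHom (sl2Incl 3) (symToQ0χ χ)

theorem projQ0χ_surjective : Function.Surjective (projQ0χ χ) := symToQ0χ_surjective χ

theorem isIntegrable_Q0χ :
    IsIntegrable ℂ (Res (sl2Incl 3) (Q0χ χ)) Sl2.h Sl2.e Sl2.f :=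
  (isIntegrable_symAlg 3).of_surjective (projQ0χ_surjective χ)

variable {χ}

theorem projQ0χ_eq_zero_iff {p : SymAlg 3} : projQ0χ χ p = 0 ↔ disc - C χ ∣ p :=
  symToQ0χ_eq_zero_iff

variable (χ)

theorem linearIndependent_projQ0χ_seminv :
    LinearIndependent ℂ fun x => projQ0χ χ (seminv x) := by
  have ker_eq_bot : LinearMap.ker
      ((projQ0χ χ : SymAlg 3 →ₗ[ℂ] Res (sl2Incl 3) (Q0χ χ)) ∘ₗ seminvForm) = ⊥ :=
    LinearMap.ker_eq_bot'.2 fun w hw =>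
      eq_zero_of_disc_sub_C_dvd_seminvForm ((projQ0χ_eq_zero_iff (p := seminvForm w)).1 hw)
  exact ((basisMonomials (Fin 2) ℂ).prod (basisMonomials (Fin 2) ℂ)).linearIndependent.map' _
    ker_eq_bot

theorem projQ0χ_mem_span_seminv {p : SymAlg 3} (hp : symDerivation Sl2.e p = 0) :
    projQ0χ χ p ∈ Submodule.span ℂ (Set.range fun x => projQ0χ χ (seminv x)) := by
  obtain ⟨w, hw⟩ := mem_seminvFormAlgebra_of_symDerivation_e_eq_zero (χ := χ) hp
  rw [← projQ0χ_eq_zero_iff, map_sub, sub_eq_zero] at hw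
  rw [hw]
  have mem_map := Submodule.mem_map_of_mem
    (f := (projQ0χ χ : SymAlg 3 →ₗ[ℂ] Res (sl2Incl 3) (Q0χ χ)) ∘ₗ seminvForm)
    (((basisMonomials (Fin 2) ℂ).prod (basisMonomials (Fin 2) ℂ)).mem_span w)
  rwa [Submodule.map_span, ← Set.range_comp] at mem_map

theorem highestWeightSpace_Q0χ_eq_span (k : ℕ) :
    highestWeightSpace (Res (sl2Incl 3) (Q0χ χ)) Sl2.h Sl2.e (k : ℂ) =
      Submodule.span ℂ ((fun x => projQ0χ χ (seminv x)) '' {x | seminvWeight x = k}) := by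
  have seminv_mem (x : SeminvIndex) :=
    map_mem_highestWeightSpace (projQ0χ χ) (seminv_mem_highestWeightSpace x)
  refine le_antisymm (fun q hq => ?_) (Submodule.span_le.2 ?_)
  · obtain ⟨p, hp, rfl⟩ := (isIntegrable_symAlg 3).exists_lift_mem_highestWeightSpace
      Sl2.isSl2Triple (projQ0χ_surjective χ) hq
    simpa only [Nat.cast_inj] using
      mem_span_image_of_mem_eigenspace (linearIndependent_projQ0χ_seminv χ)
        (fun x => (mem_highestWeightSpace.1 (seminv_mem x)).1)
        (projQ0χ_mem_span_seminv χ (mem_highestWeightSpace_symAlg.1 hp).2) hq.1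
  · rintro _ ⟨x, rfl, rfl⟩
    exact seminv_mem x

theorem finite_and_finrank_highestWeightSpace_Q0χ (k : ℕ) :
    Module.Finite ℂ (highestWeightSpace (Res (sl2Incl 3) (Q0χ χ)) Sl2.h Sl2.e (k : ℂ)) ∧
      Module.finrank ℂ (highestWeightSpace (Res (sl2Incl 3) (Q0χ χ)) Sl2.h Sl2.e (k : ℂ)) =
        k + 1 - 2 * ((k + 2) / 3) := by
  let indexEquiv := (bijOn_seminvIndex k).equiv
  have : Finite {x | seminvWeight x = k} := Finite.of_equiv _ indexEquiv.symm
  rw [highestWeightSpace_Q0χ_eq_span, Set.image_eq_range]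
  let b := Module.Basis.span ((linearIndependent_projQ0χ_seminv χ).comp
    (Subtype.val : {x | seminvWeight x = k} → SeminvIndex) Subtype.val_injective)
  refine ⟨Module.Finite.of_basis b, (Module.finrank_eq_nat_card_basis b).trans ?_⟩
  rw [Nat.card_congr indexEquiv, Nat.card_coe_set_eq, Set.ncard_Iio_nat]

end Seminvariants

theorem floor_natCast_add_two_div_three (k : ℕ) : ⌊((k : ℚ) + 2) / 3⌋ = ((k + 2) / 3 : ℕ) := by
  exact_mod_cast Rat.floor_natCast_div_natCast (k + 2) 3

theorem multiplicity_formula (k : ℕ) :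
    ((k + 1 - 2 * ((k + 2) / 3) : ℕ) : ℤ) = (k : ℤ) - 2 * ⌊((k : ℚ) + 2) / 3⌋ + 1 := by
  rw [floor_natCast_add_two_div_three]
  omega

/-! ### Simple quotients -/

section Coatom

variable {R L M : Type*} [CommRing R] [LieRing L] [LieAlgebra R L] [AddCommGroup M] [Module R M]
  [LieRingModule L M] [LieModule R L M]

omit [LieAlgebra R L] [LieModule R L M] in
theorem exists_isCoatom_of_lieSpan_singleton_eq_top [Nontrivial M] {m : M}
    (hm : LieSubmodule.lieSpan R L {m} = ⊤) : ∃ N : LieSubmodule R L M, IsCoatom N := by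
  have isCompactElement_top : IsCompactElement (⊤ : LieSubmodule R L M) :=
    hm ▸ LieSubmodule.isCompactElement_lieSpan_singleton R L m
  have := CompleteLattice.coatomic_of_top_compact isCompactElement_top
  exact IsCoatomic.exists_coatom _

theorem isIrreducible_quotient_of_isCoatom {N : LieSubmodule R L M} (hN : IsCoatom N) :
    IsIrreducible R L (M ⧸ N) := by
  have : Nontrivial (M ⧸ N) :=
    Submodule.Quotient.nontrivial_iff.2 (mt (LieSubmodule.toSubmodule_eq_top N).1 hN.1)
  refine IsIrreducible.mk fun K hK => ?_
  obtain ⟨q, hqK, hq⟩ := Submodule.exists_mem_ne_zero_of_ne_bot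
    (mt (LieSubmodule.toSubmodule_eq_bot K).1 hK)
  obtain ⟨m, rfl⟩ := LieSubmodule.Quotient.surjective_mk' N q
  have comap_eq_top : K.comap (LieSubmodule.Quotient.mk' N) = ⊤ := by
    refine hN.2 _ (SetLike.lt_iff_le_and_exists.2 ⟨fun x hx => ?_, m, hqK, fun hm => hq ?_⟩)
    · rw [LieSubmodule.mem_comap, (LieSubmodule.Quotient.mk_eq_zero N).2 hx]
      exact zero_mem K
    · exact (LieSubmodule.Quotient.mk_eq_zero N).2 hm
  refine eq_top_iff.2 fun q _ => ?_
  obtain ⟨x, rfl⟩ := LieSubmodule.Quotient.surjective_mk' N q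
  exact comap_eq_top.ge (LieSubmodule.mem_top x)

end Coatom

section SymmetricAlgebra

open MvPolynomial

variable {n : ℕ}

theorem mul_mem_lieSubmodule (W : LieSubmodule ℂ (Galilei n) (SymAlg n)) {p : SymAlg n}
    (hp : p ∈ W) (q : SymAlg n) : q * p ∈ W := by
  induction q using MvPolynomial.induction_on with
  | C a => exact C_mul' (R := ℂ) (a := a) (p := p) ▸ W.smul_mem a hp
  | add q q' hq hq' => exact add_mul q q' p ▸ add_mem hq hq'
  | mul_X q j hq =>
    rw [mul_comm q, mul_assoc, ← linForm_vec, ← inl_lie_eq]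
    exact W.lie_mem hq

/-- A submodule of the symmetric algebra of `L(n)` for `L^n`, as an ideal: the elements of `L(n)`
act by multiplication. -/
def idealOfLieSubmodule (W : LieSubmodule ℂ (Galilei n) (SymAlg n)) : Ideal (SymAlg n) where
  __ := W.toAddSubmonoid
  smul_mem' q _ hp := mul_mem_lieSubmodule W hp q

theorem lieSpan_one_symAlg :
    LieSubmodule.lieSpan ℂ (Galilei n) {(1 : SymAlg n)} = ⊤ := by
  refine eq_top_iff.2 fun p _ => ?_
  have one_mem : (1 : SymAlg n) ∈ LieSubmodule.lieSpan ℂ (Galilei n) {(1 : SymAlg n)} :=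
    LieSubmodule.subset_lieSpan (Set.mem_singleton _)
  simpa only [mul_one] using mul_mem_lieSubmodule _ one_mem p

theorem exists_map_pow_eq_zero {M : Type*} [AddCommGroup M] [Module ℂ M] [LieRingModule Sl2 M]
    [LieModule ℂ Sl2 M] [Module.Finite ℂ M] (φ : SymAlg n →ₗ⁅ℂ,Sl2⁆ M) {p : SymAlg n} {μ : ℂ}
    (hμ : μ ≠ 0) (hp : p ∈ weightSpace (SymAlg n) Sl2.h μ) : ∃ k, φ (p ^ k) = 0 := by
  by_contra! map_pow_ne_zero
  have hasEigenvector (k : ℕ) :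
      (toEnd ℂ Sl2 M Sl2.h).HasEigenvector (k * μ) (φ (p ^ k)) :=
    ⟨map_mem_weightSpace φ (pow_mem_weightSpace hp k), map_pow_ne_zero k⟩
  have weight_injective : Function.Injective fun k : ℕ => k * μ :=
    (mul_left_injective₀ hμ).comp Nat.cast_injective
  have := (Module.End.eigenvectors_linearIndependent' _ _ weight_injective _ hasEigenvector).finite
  exact not_finite ℕ

theorem sub_C_constantCoeff_mem_idealOfVars {σ R : Type*} [CommRing R] (p : MvPolynomial σ R) :
    p - C (constantCoeff p) ∈ idealOfVars σ R := by
  rw [← pow_one (idealOfVars σ R), mem_pow_idealOfVars_iff']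
  intro m hm
  obtain rfl := (Finsupp.degree_eq_zero_iff m).1 (Nat.lt_one_iff.1 hm)
  simp [constantCoeff_eq]

theorem eq_zero_of_constantCoeff_ne_zero {M : Type} [AddCommGroup M] [Module ℂ M]
    [LieRingModule (Galilei n) M] [LieModule ℂ (Galilei n) M] [Module.Finite ℂ M] (hn : Odd n)
    (φ : SymAlg n →ₗ⁅ℂ,Galilei n⁆ M) {p : SymAlg n} (hp : φ p = 0) (hp₀ : constantCoeff p ≠ 0) :
    φ = 0 := by
  let J := idealOfLieSubmodule φ.ker
  have X_mem_radical (j : Fin (n + 1)) : X j ∈ J.radical := by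
    have weight_ne_zero : (n : ℂ) - 2 * j ≠ 0 := fun h =>
      Nat.not_even_iff_odd.2 hn ⟨j, by exact_mod_cast (sub_eq_zero.1 h).trans (two_mul (j : ℂ))⟩
    have : Module.Finite ℂ (Res (sl2Incl n) M) := ‹Module.Finite ℂ M›
    exact exists_map_pow_eq_zero (resHom (sl2Incl n) φ) weight_ne_zero (X_mem_weightSpace j)
  have idealOfVars_le : idealOfVars (Fin (n + 1)) ℂ ≤ J.radical :=
    Ideal.span_le.2 (Set.range_subset_iff.2 X_mem_radical)
  have C_mem_radical : C (constantCoeff p) ∈ J.radical :=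
    (Submodule.sub_mem_iff_right _ (Ideal.le_radical (show p ∈ J from hp))).1
      (idealOfVars_le (sub_C_constantCoeff_mem_idealOfVars p))
  have J_eq_top : J = ⊤ := Ideal.radical_eq_top.1 <|
    Ideal.eq_top_of_isUnit_mem _ C_mem_radical (hp₀.isUnit.map C)
  exact LieModuleHom.ext fun q => show q ∈ J from J_eq_top ▸ Submodule.mem_top

end SymmetricAlgebra

section Quotient

open MvPolynomial

variable (χ : ℂ)

theorem symToQ0χ_one_ne_zero : symToQ0χ χ 1 ≠ 0 := by
  have projQ0χ_ne_zero := (linearIndependent_projQ0χ_seminv χ).ne_zero (Sum.inl 0)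
  rwa [seminv_inl, Finsupp.zero_apply, Finsupp.zero_apply, pow_zero, pow_zero, mul_one]
    at projQ0χ_ne_zero

theorem lieSpan_symToQ0χ_one :
    LieSubmodule.lieSpan ℂ (Galilei 3) {symToQ0χ χ 1} = ⊤ := by
  have lieSpan_one_le : LieSubmodule.lieSpan ℂ (Galilei 3) {(1 : SymAlg 3)} ≤
      (LieSubmodule.lieSpan ℂ (Galilei 3) {symToQ0χ χ 1}).comap (symToQ0χ χ) :=
    LieSubmodule.lieSpan_le.2 (Set.singleton_subset_iff.2
      (LieSubmodule.subset_lieSpan (Set.mem_singleton _)))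
  refine eq_top_iff.2 fun q _ => ?_
  obtain ⟨p, rfl⟩ := symToQ0χ_surjective χ q
  exact lieSpan_one_le (lieSpan_one_symAlg.ge (LieSubmodule.mem_top p))

theorem exists_isCoatom_Q0χ : ∃ N : LieSubmodule ℂ (Galilei 3) (Q0χ χ), IsCoatom N :=
  have := nontrivial_of_ne _ _ (symToQ0χ_one_ne_zero χ)
  exists_isCoatom_of_lieSpan_singleton_eq_top (lieSpan_symToQ0χ_one χ)

theorem isHarishChandra_Q0χ : IsHarishChandra (sl2Incl 3) (Q0χ χ) :=
  (isIntegrable_Q0χ χ).exists_isSimpleDecomposition_finite fun k =>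
    (finite_and_finrank_highestWeightSpace_Q0χ χ k).1

theorem isHarishChandra_quotient (N : LieSubmodule ℂ (Galilei 3) (Q0χ χ)) :
    IsHarishChandra (sl2Incl 3) (Q0χ χ ⧸ N) := by
  have resHom_surjective : Function.Surjective
      (resHom (sl2Incl 3) (LieSubmodule.Quotient.mk' N)) := LieSubmodule.Quotient.surjective_mk' N
  refine ((isIntegrable_Q0χ χ).of_surjective resHom_surjective).exists_isSimpleDecomposition_finite
    fun k => ?_
  have := (finite_and_finrank_highestWeightSpace_Q0χ χ k).1
  exact (isIntegrable_Q0χ χ).finite_highestWeightSpace_of_surjective Sl2.isSl2Triple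
    resHom_surjective k

variable {χ}

theorem not_finite_quotient (hχ : χ ≠ 0) {N : LieSubmodule ℂ (Galilei 3) (Q0χ χ)} (hN : N ≠ ⊤) :
    ¬ Module.Finite ℂ (Q0χ χ ⧸ N) := by
  intro
  let φ := (LieSubmodule.Quotient.mk' N).comp (symToQ0χ χ)
  have map_disc_sub_C : φ (disc - C χ) = 0 :=
    (congrArg (LieSubmodule.Quotient.mk' N) (symToQ0χ_eq_zero_iff.2 dvd_rfl)).trans (map_zero _)
  have constantCoeff_ne_zero : constantCoeff (disc - C χ) ≠ 0 := by simpa [disc] using hχ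
  have φ_eq_zero : φ = 0 :=
    eq_zero_of_constantCoeff_ne_zero (by decide) φ map_disc_sub_C constantCoeff_ne_zero
  refine hN (eq_top_iff.2 fun q _ => ?_)
  obtain ⟨p, rfl⟩ := symToQ0χ_surjective χ q
  exact (LieSubmodule.Quotient.mk_eq_zero N).1 (LieModuleHom.congr_fun φ_eq_zero p)

end Quotient

/-! ### The radical -/

section Radical

theorem radical_le_ker_of_surjective {R L L' : Type*} [CommRing R] [LieRing L] [LieAlgebra R L]
    [LieRing L'] [LieAlgebra R L'] [LieAlgebra.HasTrivialRadical R L'] {φ : L →ₗ⁅R⁆ L'}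
    (hφ : Function.Surjective φ) : LieAlgebra.radical R L ≤ φ.ker := by
  refine sSup_le fun I (hI : LieAlgebra.IsSolvable I) => ?_
  have derivedSeries_map (k : ℕ) : LieAlgebra.derivedSeriesOfIdeal R L' k (I.map φ) =
      (LieAlgebra.derivedSeriesOfIdeal R L k I).map φ := by
    induction k with
    | zero => rfl
    | succ k ih =>
      rw [LieAlgebra.derivedSeriesOfIdeal_succ, LieAlgebra.derivedSeriesOfIdeal_succ, ih,
        LieIdeal.map_bracket_eq φ hφ]
  obtain ⟨k, hk⟩ := LieAlgebra.IsSolvable.solvable R I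
  rw [LieIdeal.derivedSeries_eq_bot_iff] at hk
  have isSolvable_map : LieAlgebra.IsSolvable (I.map φ) := by
    refine LieAlgebra.IsSolvable.mk (R := R) (k := k) ((LieIdeal.derivedSeries_eq_bot_iff _ _).2 ?_)
    rw [derivedSeries_map, hk, LieIdeal.map_eq_bot_iff]
    exact bot_le
  rw [← LieIdeal.map_eq_bot_iff]
  exact LieAlgebra.HasTrivialRadical.eq_bot_of_isSolvable _

theorem exists_not_isNilpotent_ad_of_isCartanSubalgebra {K L : Type*} [Field K] [LieRing L]
    [LieAlgebra K L] [FiniteDimensional K L] [LieAlgebra.IsKilling K L] [Nontrivial L]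
    (H : LieSubalgebra K L) [H.IsCartanSubalgebra] :
    ∃ x ∈ H, ¬ IsNilpotent (LieAlgebra.ad K L x) := by
  by_contra! isNilpotent_ad
  have eq_zero_of_mem {x : L} (hx : x ∈ H) : x = 0 :=
    LieAlgebra.IsKilling.eq_zero_of_isNilpotent_ad_of_mem_isCartanSubalgebra K L H hx
      (isNilpotent_ad x hx)
  obtain ⟨x, hx⟩ := exists_ne (0 : L)
  refine hx (eq_zero_of_mem ?_)
  rw [← LieSubalgebra.IsCartanSubalgebra.self_normalizing (H := H),
    LieSubalgebra.mem_normalizer_iff]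
  intro y hy
  rw [eq_zero_of_mem hy, lie_zero]
  exact zero_mem H

namespace Sl2

theorem eq_top_of_h_mem {I : LieIdeal ℂ Sl2} (hI : h ∈ I) : I = ⊤ := by
  have e_mem : (2 : ℂ) • e ∈ I := isSl2Triple.lie_h_e_smul ℂ ▸ lie_mem_left ℂ Sl2 I h e hI
  have f_mem : -((2 : ℂ) • f) ∈ I := isSl2Triple.lie_lie_smul_f ℂ ▸ lie_mem_left ℂ Sl2 I h f hI
  refine eq_top_iff.2 fun x _ => ?_
  rw [eq_smul_add_smul_add_smul x]
  refine add_mem (add_mem (I.smul_mem _ hI) (I.smul_mem _ ?_)) (I.smul_mem _ ?_)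
  · exact (I.toSubmodule.smul_mem_iff two_ne_zero).1 e_mem
  · exact (I.toSubmodule.smul_mem_iff two_ne_zero).1 (neg_mem_iff.1 f_mem)

theorem lie_f_lie_e_lie_e (x : Sl2) : ⁅f, ⁅e, ⁅e, x⁆⁆⁆ = (2 * x.1 1 0) • h := by
  ext i j
  fin_cases i <;> fin_cases j <;> simp [h, e, f, Ring.lie_def] <;> ring

theorem lie_e_lie_f_lie_f (x : Sl2) : ⁅e, ⁅f, ⁅f, x⁆⁆⁆ = -(2 * x.1 0 1) • h := by
  ext i j
  fin_cases i <;> fin_cases j <;> simp [h, e, f, Ring.lie_def] <;> ring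

instance : Nontrivial Sl2 := ⟨h, 0, isSl2Triple.h_ne_zero⟩

instance : LieAlgebra.IsSimple ℂ Sl2 where
  eq_bot_or_eq_top I := by
    refine or_iff_not_imp_left.2 fun hI => ?_
    obtain ⟨x, hx, hx₀⟩ := Submodule.exists_mem_ne_zero_of_ne_bot
      (mt (LieSubmodule.toSubmodule_eq_bot I).1 hI)
    have eq_top_of_smul_mem {c : ℂ} (hc : c ≠ 0) (hch : c • h ∈ I) : I = ⊤ :=
      eq_top_of_h_mem ((I.toSubmodule.smul_mem_iff hc).1 hch)
    by_contra hI_top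
    have c_eq_zero : x.1 1 0 = 0 := by
      by_contra hc
      exact hI_top (eq_top_of_smul_mem (mul_ne_zero two_ne_zero hc)
        (lie_f_lie_e_lie_e x ▸ I.lie_mem (I.lie_mem (I.lie_mem hx))))
    have b_eq_zero : x.1 0 1 = 0 := by
      by_contra hb
      exact hI_top (eq_top_of_smul_mem (neg_ne_zero.2 (mul_ne_zero two_ne_zero hb))
        (lie_e_lie_f_lie_f x ▸ I.lie_mem (I.lie_mem (I.lie_mem hx))))
    have x_eq : x = x.1 0 0 • h := by
      conv_lhs => rw [eq_smul_add_smul_add_smul x]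
      rw [b_eq_zero, c_eq_zero, zero_smul, zero_smul, add_zero, add_zero]
    refine hI_top (eq_top_of_smul_mem (fun ha => hx₀ ?_) (x_eq ▸ hx))
    rw [x_eq, ha, zero_smul]
  non_abelian := LieAlgebra.SpecialLinear.sl_non_abelian (Fin 2) ℂ (by decide)

theorem isNilpotent_ad_of_det_eq_zero {x : Sl2} (hx : x.1.det = 0) :
    IsNilpotent (LieAlgebra.ad ℂ Sl2 x) := by
  refine LieAlgebra.isNilpotent_ad_of_isNilpotent ⟨2, ?_⟩
  have cayley_hamilton := x.1.aeval_self_charpoly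
  simpa [Matrix.charpoly_fin_two, Matrix.trace_fin_two, apply_one_one, hx] using cayley_hamilton

end Sl2

theorem lie_lie_lie_lie_irrep_three (x : Sl2) (w : Irrep 3) :
    ⁅x, ⁅x, ⁅x, ⁅x, w⁆⁆⁆⁆ + (10 * x.1.det) • ⁅x, ⁅x, w⁆⁆ + (9 * x.1.det ^ 2) • w = 0 := by
  rw [Matrix.det_fin_two, Sl2.apply_one_one]
  refine Irrep.ext_coord fun j hj => ?_
  interval_cases j <;>
  simp [Irrep.coord_lie, Irrep.coord_of_le, Irrep.coord_add, Irrep.coord_smul, Irrep.coord_zero] <;>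
  ring

theorem irrep_three_eq_zero_of_lie_eq_zero {x : Sl2} (hx : x.1.det ≠ 0) {w : Irrep 3}
    (hw : ⁅x, w⁆ = 0) : w = 0 := by
  have smul_eq_zero' := lie_lie_lie_lie_irrep_three x w
  simp only [hw, lie_zero, smul_zero, zero_add] at smul_eq_zero'
  exact (smul_eq_zero.1 smul_eq_zero').resolve_left
    (mul_ne_zero (by norm_num) (pow_ne_zero 2 hx))

theorem radicalZeroWeightSpace_eq_bot (𝔥 : LieSubalgebra ℂ Sl2) [𝔥.IsCartanSubalgebra] :
    radicalZeroWeightSpace (sl2Incl 3) 𝔥 = ⊥ := by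
  rw [eq_bot_iff]
  rintro ⟨w, y⟩ ⟨hrad, hzero⟩
  obtain rfl : y = 0 := radical_le_ker_of_surjective
    (LieAlgebra.SemiDirectSum.projr_surjective (Irrep.derivation 3)) hrad
  obtain ⟨x, hx, hx_ad⟩ := exists_not_isNilpotent_ad_of_isCartanSubalgebra 𝔥
  have lie_eq_zero : ⁅x, w⁆ = 0 := by
    have left_eq_zero := congrArg LieAlgebra.SemiDirectSum.left (hzero x hx)
    change ⁅(0 : Irrep 3), w⁆ + ⁅x, w⁆ - ⁅(0 : Sl2), (0 : Irrep 3)⁆ = 0 at left_eq_zero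
    rwa [zero_lie, zero_lie, zero_add, sub_zero] at left_eq_zero
  obtain rfl := irrep_three_eq_zero_of_lie_eq_zero
    (mt Sl2.isNilpotent_ad_of_det_eq_zero hx_ad) lie_eq_zero
  exact Submodule.zero_mem _

end Radical

end HarishChandra

end

open HarishChandra in
theorem proposition7p1 :
    (∀ χ : ℂ, χ ≠ 0 →
      IsHarishChandra (sl2Incl 3) (Q0χ χ) ∧
      (∀ s : Set (LieSubmodule ℂ Sl2 (Res (sl2Incl 3) (Q0χ χ))), IsSimpleDecomposition s →
        ∀ k : ℕ, (summandsOfType s (Irrep k)).Finite ∧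
          ((summandsOfType s (Irrep k)).ncard : ℤ) = (k : ℤ) - 2 * ⌊((k : ℚ) + 2) / 3⌋ + 1) ∧
      (∃ N : LieSubmodule ℂ (Galilei 3) (Q0χ χ),
        LieModule.IsIrreducible ℂ (Galilei 3) (Q0χ χ ⧸ N) ∧
        ¬ Module.Finite ℂ (Q0χ χ ⧸ N) ∧
        IsHarishChandra (sl2Incl 3) (Q0χ χ ⧸ N))) ∧
    (∀ 𝔥 : LieSubalgebra ℂ Sl2, 𝔥.IsCartanSubalgebra →
      (⁅(⊤ : LieIdeal ℂ (Galilei 3)), LieAlgebra.radical ℂ (Galilei 3)⁆).toSubmodule ⊓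
        radicalZeroWeightSpace (sl2Incl 3) 𝔥 = ⊥) := by
  refine ⟨fun χ hχ => ⟨isHarishChandra_Q0χ χ, fun s hs k => ?_, ?_⟩, fun 𝔥 h𝔥 => ?_⟩
  · obtain ⟨hfin, hrank⟩ := finite_and_finrank_highestWeightSpace_Q0χ χ k
    obtain ⟨hs_fin, hs_card⟩ := hs.finite_and_ncard_summandsOfType (isIntegrable_Q0χ χ) k
    exact ⟨hs_fin, by rw [hs_card, hrank, multiplicity_formula]⟩
  · obtain ⟨N, hN⟩ := exists_isCoatom_Q0χ χ
    exact ⟨N, isIrreducible_quotient_of_isCoatom hN, not_finite_quotient hχ hN.1,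
      isHarishChandra_quotient χ N⟩
  · rw [radicalZeroWeightSpace_eq_bot 𝔥, inf_bot_eq]
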